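/- Let $N\ge 2$ and let $k:(0,\infty)\to[0,\infty)$ be a nonincreasing function which is strictly decreasing on $(0,r_0)$ for some $r_0>0$ and satisfies \[ \int_0^\infty \min\{1,r^2\}\,k(r)\,r^{N-1}\,dr<\infty ,\qquad \int_0^\infty k(r)\,r^{N-1}\,dr=\infty . \] For measurable $v,w:\mathbb R^N\to\mathbb R$ put \[ \mathcal J(v,w)=\frac12\int_{\mathbb R^N}\int_{\mathbb R^N}(v(x)-v(y))(w(x)-w(y))\,k(|x-y|)\,dx\,dy \] (whenever this makes sense), and for open $\Omega\subset\mathbb R^N$ let \[ \mathcal D^J(\Omega)=\{u\in L^2(\mathbb R^N):\ \mathcal J(u,u)<\infty,\ u=0 \text{ on } \mathbb R^N\setminus\Omega\}. \] Let $\Omega\subset\mathbb R^N$ be a bounded open set which is radial (if $x\in\Omega$ and $|y|=|x|$, then $y\in\Omega$). If $\Omega$ is not connected, assume in addition that $k$ is strictly decreasing on $(0,\infty)$. Let $f:[0,\infty)\times\mathbb R\to\mathbb R$ be such that for every $K>0$ there is $L=L(K)>0$ with \[ \sup_{r\ge 0}|f(r,s)-f(r,t)|\le L|s-t|\qquad\text{for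 all } s,t\in[-K,K]. \] Let $u:\mathbb R^N\to\mathbb R$ be bounded, continuous in $\Omega$ and equal to $0$ on $\mathbb R^N\setminus\Omega$, and let $u$ be a weak solution of \[ Iu=f(|x|,u)\ \text{ in }\Omega,\qquad u=0\ \text{ on }\mathbb R^N\setminus\Omega, \] where $I$ is the nonlocal operator with kernel $k$ (i.e. the operator associated with $\mathcal J$). That is, $u\in\mathcal D^J(\Omega)$ and for every $\varphi\in\mathcal D^J(\Omega)$ with compact support the function $x\mapsto f(|x|,u(x))\varphi(x)$ is integrable and \[ \mathcal J(u,\varphi)=\int_\Omega f(|x|,u(x))\varphi(x)\,dx . \] Assume that there is a unit vector $e\in\mathbb R^N$ such that, with $H=\{x: x\cdot e>0\}$ and $Q$ the reflection at the hyperplane $\partial H$, one has $u\ge u\circ Q$ on $H$ and $u\not\equiv u\circ Q$ on $H$. Then $u$ is foliated Schwarz symmetric in $\Omega$: there is a unit vector $p\in\mathbb R^N$ such that for every $r>0$ with $\{|x|=r\}\subset\Omega$ and every $c\in\mathbb R$ the set $\{x: |x|=r,\ u(x)\ge c\}$ is empty, or the whole sphere $\{|x|=r\}$, or a closed geodesic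 ball in that sphere centred at $rp$. -/

import Mathlib

open MeasureTheory Set

noncomputable section

/-- A radial set: membership depends only on the Euclidean norm. -/
def IsRadialSet {N : ℕ} (Ω : Set (EuclideanSpace ℝ (Fin N))) : Prop :=
  ∀ x y : EuclideanSpace ℝ (Fin N), ‖x‖ = ‖y‖ → x ∈ Ω → y ∈ Ω

/-- A nonincreasing `k : (0, ∞) → [0, ∞)` that is strictly decreasing near zero, with
`∫₀^∞ min {1, r²} k(r) r^(N-1) dr < ∞` and `∫₀^∞ k(r) r^(N-1) dr = ∞`.
Only the values of `k` on `(0, ∞)` matter. -/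
structure KernelCondition (N : ℕ) (k : ℝ → ℝ) : Prop where
  nonneg : ∀ r : ℝ, 0 < r → 0 ≤ k r
  antitone : AntitoneOn k (Ioi 0)
  strict_near_zero : ∃ r₀ : ℝ, 0 < r₀ ∧ StrictAntiOn k (Ioo 0 r₀)
  levy : ∫⁻ r in Ioi (0 : ℝ), ENNReal.ofReal (min 1 (r ^ 2) * k r * r ^ (N - 1)) < ⊤
  singular : ∫⁻ r in Ioi (0 : ℝ), ENNReal.ofReal (k r * r ^ (N - 1)) = ⊤

/-- `f : [0, ∞) × ℝ → ℝ` is locally Lipschitz in its second variable, uniformly in the first. -/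
def UniformlyLocallyLipschitz (f : ℝ → ℝ → ℝ) : Prop :=
  ∀ K : ℝ, 0 < K → ∃ L : ℝ, 0 < L ∧ ∀ r : ℝ, 0 ≤ r →
    ∀ u ∈ Icc (-K) K, ∀ v ∈ Icc (-K) K, |f r u - f r v| ≤ L * |u - v|

/-- The bilinear form
`J(v, w) = (1/2) ∫∫ (v(x) - v(y)) (w(x) - w(y)) k(|x - y|) dx dy`. -/
def bilinForm {N : ℕ} (k : ℝ → ℝ) (v w : EuclideanSpace ℝ (Fin N) → ℝ) : ℝ :=
  (1 / 2) * ∫ p : EuclideanSpace ℝ (Fin N) × EuclideanSpace ℝ (Fin N),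
    (v p.1 - v p.2) * (w p.1 - w p.2) * k ‖p.1 - p.2‖

/-- Membership in the space of all `u ∈ L²(ℝ^N)` with `J(u, u) < ∞` and `u = 0` outside `Ω`. -/
structure MemEnergySpace {N : ℕ} (k : ℝ → ℝ) (Ω : Set (EuclideanSpace ℝ (Fin N)))
    (u : EuclideanSpace ℝ (Fin N) → ℝ) : Prop where
  memLp : MemLp u 2 volume
  energy_lt_top : ∫⁻ p : EuclideanSpace ℝ (Fin N) × EuclideanSpace ℝ (Fin N),
    ENNReal.ofReal ((u p.1 - u p.2) ^ 2 * k ‖p.1 - p.2‖) < ⊤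
  eq_zero : ∀ x, x ∉ Ω → u x = 0

/-- Weak solutions of `I u = f(|x|, u)` in `Ω`, `u = 0` on `ℝ^N \ Ω`, where `I` is the nonlocal
operator with kernel `k`: the function `u` lies in the energy space and, for each compactly
supported `φ` in the energy space, `f(|x|, u) φ` is integrable and
`J(u, φ) = ∫_Ω f(|x|, u(x)) φ(x) dx`. -/
structure IsWeakSolution {N : ℕ} (k : ℝ → ℝ) (f : ℝ → ℝ → ℝ)
    (Ω : Set (EuclideanSpace ℝ (Fin N))) (u : EuclideanSpace ℝ (Fin N) → ℝ) : Prop where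
  mem : MemEnergySpace k Ω u
  weak_eq : ∀ φ : EuclideanSpace ℝ (Fin N) → ℝ, MemEnergySpace k Ω φ → HasCompactSupport φ →
    Integrable (fun x => f ‖x‖ (u x) * φ x) ∧
      bilinForm k u φ = ∫ x in Ω, f ‖x‖ (u x) * φ x

/-- For some unit vector `e`, with `H = {x | x · e > 0}` and `Q` the reflection at `∂H`, one has
`u ≥ u ∘ Q` on `H` and `u` is not identically equal to `u ∘ Q` on `H`. -/
def ReflectionInequality {N : ℕ} (u : EuclideanSpace ℝ (Fin N) → ℝ) : Prop :=
  ∃ e : EuclideanSpace ℝ (Fin N), ‖e‖ = 1 ∧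
    (∀ x, 0 < inner ℝ x e → u ((Submodule.span ℝ {e})ᗮ.reflection x) ≤ u x) ∧
    ∃ x, 0 < inner ℝ x e ∧ u x ≠ u ((Submodule.span ℝ {e})ᗮ.reflection x)

/-- The closed geodesic ball of radius `ρ` and centre `r p` (with `|p| = 1`) in the sphere of
radius `r > 0` about the origin; the geodesic distance there is `r` times the angle. -/
def geodesicBall {N : ℕ} (r : ℝ) (p : EuclideanSpace ℝ (Fin N)) (ρ : ℝ) :
    Set (EuclideanSpace ℝ (Fin N)) :=
  {x | ‖x‖ = r ∧ r * InnerProductGeometry.angle x (r • p) ≤ ρ}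

/-- Foliated Schwarz symmetry of `u` in the radial set `Ω`: there is one unit vector `p` such that
on each sphere of radius `r > 0` contained in `Ω`, each superlevel set `{u ≥ c}` is
the whole sphere or a geodesic ball centred at `r p`, where the empty set (the case in which `c`
exceeds all values of `u` on the sphere) counts as a degenerate ball. The balls are closed, since
the functions considered are continuous on these spheres. -/
def IsFoliatedSchwarzSymmetric {N : ℕ} (Ω : Set (EuclideanSpace ℝ (Fin N)))
    (u : EuclideanSpace ℝ (Fin N) → ℝ) : Prop :=
  ∃ p : EuclideanSpace ℝ (Fin N), ‖p‖ = 1 ∧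
    ∀ r : ℝ, 0 < r → Metric.sphere (0 : EuclideanSpace ℝ (Fin N)) r ⊆ Ω → ∀ c : ℝ,
      {x | ‖x‖ = r ∧ c ≤ u x} = ∅ ∨
      {x | ‖x‖ = r ∧ c ≤ u x} = Metric.sphere (0 : EuclideanSpace ℝ (Fin N)) r ∨
      ∃ ρ : ℝ, 0 ≤ ρ ∧ {x | ‖x‖ = r ∧ c ≤ u x} = geodesicBall r p ρ

end

/-!
The proof is a rotating plane argument. For a vector `w` let `Q_w = hypRefl w` be the reflection at
the hyperplane orthogonal to `w`, let `H_w` be the half-space `{x | 0 < ⟪x, w⟫}`, and let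
`v_w = u - u ∘ Q_w`. Since the equation is radial and `f` is Lipschitz on the range of `u`, the
function `v_w`, which is odd with respect to `Q_w`, is a weak supersolution of `I v ≥ -L |v|` in
`Ω`, with `L` independent of `w` (`IsWeakSolution.isAntisymmetricSupersolution`).

Two maximum principles hold for such functions. Both use the test function `φ` given by the negative
part of an odd function `v` on `H_w` (`halfNegPart`): as the kernel at `(x, y)` dominates the one
at `(x, Q_w y)` for `x, y ∈ H_w`, one has `J(v, φ) ≤ -J(φ, φ)`, with an additional gain from any set
on which `v` is bounded below (`energyForm_halfNegPart_le`).

* If `v ≥ 0` on `H_w` up to a subset of `Ω` of small measure, then `v ≥ 0` on `H_w`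
  (`exists_small_volume_maximum_principle`), because the kernel is not integrable and so
  `J(φ, φ)` controls a large multiple of `∫ φ²` (`IsLevyKernel.exists_volume_poincare`).
* If `v ≥ 0` on `H_w` and `v` does not vanish identically, then `v > 0` on `Ω ∩ H_w`
  (`IsAntisymmetricSupersolution.pos`). Here `v` is compared with a small multiple of a paraboloid,
  and strict monotonicity of the kernel makes the gain beat the cost of the paraboloid.

Let `C` be the set of all `w ≠ 0` with `v_w > 0` on `Ω ∩ H_w`, and let `Z` be the set of all `w`
with `v_w = 0` (`positiveDirections`, `symmetricDirections`). The maximum principles show that `C`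
is open and that its closure is contained in `C ∪ Z`. A plane spanned by two directions in `Z`
cannot meet `C`: the product of the two reflections is a rotation of the plane which leaves
`v_a` invariant for every `a` in the plane, whereas it moves the half-space `H_a`
(`add_smul_notMem_symmetricDirections`). Therefore `C + Z ⊆ C`, which implies that `C` is a convex
cone and that `C ∪ -C ∪ Z` is the whole space. A vector `p` with `⟪w, p⟫ > 0` on `C`, which exists
by the Hahn-Banach theorem, is the axis of symmetry: if `‖x‖ = ‖y‖` and `⟪x, p⟫ ≥ ⟪y, p⟫`, then
`x - y ∉ -C`, and so `u x ≥ u y` (`exists_axis`).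
-/

/-! ### Reflections at hyperplanes through the origin -/

section Reflection

variable {E : Type*} [NormedAddCommGroup E] [InnerProductSpace ℝ E]

/-- The reflection at the hyperplane orthogonal to `w`; it is the identity for `w = 0`. -/
noncomputable def hypRefl (w : E) : E ≃ₗᵢ[ℝ] E := (Submodule.span ℝ {w})ᗮ.reflection

theorem hypRefl_apply (w x : E) :
    hypRefl w x = x - (2 * inner ℝ x w / ‖w‖ ^ 2) • w := by
  rw [hypRefl, Submodule.reflection_orthogonal_apply, Submodule.reflection_singleton_apply,
    real_inner_comm, neg_sub]
  congr 1
  rw [two_smul, ← add_smul]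
  congr 1
  simp only [RCLike.ofReal_real_eq_id, id_eq]
  ring

@[simp] theorem hypRefl_hypRefl (w x : E) : hypRefl w (hypRefl w x) = x :=
  Submodule.reflection_reflection _ x

@[simp] theorem hypRefl_zero (x : E) : hypRefl (0 : E) x = x := by simp [hypRefl_apply]

@[simp] theorem inner_hypRefl (w x : E) : inner ℝ (hypRefl w x) w = - inner ℝ x w := by
  rcases eq_or_ne w 0 with rfl | hw
  · simp
  · have : ‖w‖ ≠ 0 := norm_ne_zero_iff.2 hw
    rw [hypRefl_apply, inner_sub_left, real_inner_smul_left, real_inner_self_eq_norm_sq]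
    field_simp
    ring

theorem hypRefl_eq_self {w x : E} (h : inner ℝ x w = 0) : hypRefl w x = x := by
  simp [hypRefl_apply, h]

theorem hypRefl_smul {c : ℝ} (hc : c ≠ 0) (w x : E) : hypRefl (c • w) x = hypRefl w x := by
  rcases eq_or_ne w 0 with rfl | hw
  · simp
  · have : ‖w‖ ≠ 0 := norm_ne_zero_iff.2 hw
    rw [hypRefl_apply, hypRefl_apply, real_inner_smul_right, smul_smul, norm_smul, mul_pow,
      Real.norm_eq_abs, sq_abs]
    congr 2
    field_simp

theorem norm_hypRefl_sub_hypRefl (w x y : E) : ‖hypRefl w x - hypRefl w y‖ = ‖x - y‖ := by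
  rw [← map_sub, LinearIsometryEquiv.norm_map]

theorem norm_hypRefl_sub (w x y : E) : ‖hypRefl w x - y‖ = ‖x - hypRefl w y‖ := by
  rw [← norm_hypRefl_sub_hypRefl w (hypRefl w x), hypRefl_hypRefl]

theorem norm_sub_hypRefl_sq (w x y : E) :
    ‖x - hypRefl w y‖ ^ 2 = ‖x - y‖ ^ 2 + 4 * inner ℝ x w * inner ℝ y w / ‖w‖ ^ 2 := by
  rcases eq_or_ne w 0 with rfl | hw
  · simp
  · have : ‖w‖ ≠ 0 := norm_ne_zero_iff.2 hw
    rw [hypRefl_apply, ← sub_add, norm_add_sq_real, norm_smul, real_inner_smul_right,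
      inner_sub_left, mul_pow, Real.norm_eq_abs, sq_abs]
    field_simp
    ring

theorem norm_sub_le_norm_sub_hypRefl {w x y : E} (hx : 0 ≤ inner ℝ x w) (hy : 0 ≤ inner ℝ y w) :
    ‖x - y‖ ≤ ‖x - hypRefl w y‖ := by
  rw [← pow_le_pow_iff_left₀ (norm_nonneg _) (norm_nonneg _) two_ne_zero, norm_sub_hypRefl_sq]
  have : 0 ≤ 4 * inner ℝ x w * inner ℝ y w / ‖w‖ ^ 2 := by positivity
  linarith

theorem norm_sub_lt_norm_sub_hypRefl {w x y : E} (hx : 0 < inner ℝ x w) (hy : 0 < inner ℝ y w) :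
    ‖x - y‖ < ‖x - hypRefl w y‖ := by
  have hw : w ≠ 0 := by rintro rfl; simp at hx
  have : 0 < ‖w‖ := norm_pos_iff.2 hw
  rw [← pow_lt_pow_iff_left₀ (norm_nonneg _) (norm_nonneg _) two_ne_zero, norm_sub_hypRefl_sq]
  have : 0 < 4 * inner ℝ x w * inner ℝ y w / ‖w‖ ^ 2 := by positivity
  linarith

/-- The joint continuity of `(w, x) ↦ hypRefl w x` away from `w = 0`. -/
theorem continuousAt_hypRefl {w : E} (hw : w ≠ 0) (x : E) :
    ContinuousAt (fun p : E × E => hypRefl p.1 p.2) (w, x) := by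
  have : (fun p : E × E => hypRefl p.1 p.2) =
      fun p : E × E => p.2 - (2 * inner ℝ p.2 p.1 / ‖p.1‖ ^ 2) • p.1 :=
    funext fun p => hypRefl_apply _ _
  rw [this]
  have h0 : ‖w‖ ^ 2 ≠ 0 := pow_ne_zero _ (norm_ne_zero_iff.2 hw)
  refine continuousAt_snd.sub (ContinuousAt.smul ?_ continuousAt_fst)
  refine ContinuousAt.div ?_ ?_ h0
  · fun_prop
  · fun_prop

/-- In the plane spanned by `a` and `z`, the product of three reflections is again a reflection,
so that it equals its own inverse. -/
theorem hypRefl_comp_three (a z : E) (s : ℝ) (ha : a ≠ 0) (hz : z ≠ 0) (h : a + s • z ≠ 0)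
    (x : E) : hypRefl a (hypRefl z (hypRefl (a + s • z) x)) =
      hypRefl (a + s • z) (hypRefl z (hypRefl a x)) := by
  have e3 : ‖a + s • z‖ ^ 2 = ‖a‖ ^ 2 + 2 * s * inner ℝ a z + s ^ 2 * ‖z‖ ^ 2 := by
    rw [norm_add_sq_real, norm_smul, real_inner_smul_right, mul_pow, Real.norm_eq_abs, sq_abs]
    ring
  have h1 : ‖a‖ ^ 2 ≠ 0 := pow_ne_zero _ (norm_ne_zero_iff.2 ha)
  have h2 : ‖z‖ ^ 2 ≠ 0 := pow_ne_zero _ (norm_ne_zero_iff.2 hz)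
  have h3 : ‖a + s • z‖ ^ 2 ≠ 0 := pow_ne_zero _ (norm_ne_zero_iff.2 h)
  rw [e3] at h3
  simp only [hypRefl_apply, e3, inner_sub_left, inner_add_left, inner_add_right,
    real_inner_smul_left, real_inner_smul_right, real_inner_self_eq_norm_sq,
    real_inner_comm a z]
  generalize ‖a‖ ^ 2 = A at *
  generalize ‖z‖ ^ 2 = B at *
  generalize inner ℝ a z = c at *
  generalize inner ℝ x a = X
  generalize inner ℝ x z = Y
  match_scalars <;> field_simp <;> ring

end Reflection

/-! ### The nonlocal energy -/

section HalfNegPart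

variable {E : Type*} [NormedAddCommGroup E] [InnerProductSpace ℝ E] {v : E → ℝ}

/-- The negative part of `v` on the open half-space `{x | 0 < ⟪x, w⟫}`, and zero elsewhere. -/
noncomputable def halfNegPart (w : E) (v : E → ℝ) (x : E) : ℝ :=
  if 0 < inner ℝ x w then max (-v x) 0 else 0

theorem halfNegPart_nonneg (w : E) (v : E → ℝ) (x : E) : 0 ≤ halfNegPart w v x := by
  rw [halfNegPart]
  split_ifs
  exacts [le_max_right _ _, le_rfl]

theorem halfNegPart_of_pos {w x : E} (h : 0 < inner ℝ x w) :
    halfNegPart w v x = max (-v x) 0 := if_pos h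

theorem halfNegPart_of_nonpos {w x : E} (h : inner ℝ x w ≤ 0) :
    halfNegPart w v x = 0 := if_neg h.not_gt

theorem halfNegPart_eq_zero {w x : E} (h : 0 ≤ v x) : halfNegPart w v x = 0 := by
  rw [halfNegPart]
  split_ifs
  exacts [max_eq_right (by linarith), rfl]

theorem halfNegPart_le_abs (w : E) (v : E → ℝ) (x : E) : halfNegPart w v x ≤ |v x| := by
  rw [halfNegPart]
  split_ifs
  exacts [max_le (neg_le_abs _) (abs_nonneg _), abs_nonneg _]

end HalfNegPart

section Energy

variable {E : Type*} [NormedAddCommGroup E] [InnerProductSpace ℝ E] [FiniteDimensional ℝ E]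
  [MeasurableSpace E] [BorelSpace E]

variable (E) in
/-- A radial Lévy kernel `z ↦ k ‖z‖` on `E`: nonincreasing, of finite second moment near zero,
integrable at infinity, and not integrable. Contrary to `KernelCondition`, it is required to be
measurable and nonnegative on the whole line, and normalized to vanish at zero, a value which does
not affect energies. -/
structure IsLevyKernel (k : ℝ → ℝ) : Prop where
  measurable : Measurable k
  nonneg : ∀ r, 0 ≤ k r
  map_zero : k 0 = 0
  antitone : AntitoneOn k (Ioi 0)
  levy : Integrable fun z : E => min 1 (‖z‖ ^ 2) * k ‖z‖
  singular : ¬ Integrable fun z : E => k ‖z‖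

/-- The function `v` has finite energy. -/
def HasEnergy (k : ℝ → ℝ) (v : E → ℝ) : Prop :=
  Integrable fun p : E × E => (v p.1 - v p.2) ^ 2 * k ‖p.1 - p.2‖

/-- Twice the form `J`, for functions on `E`. -/
noncomputable def energyForm (k : ℝ → ℝ) (v w : E → ℝ) : ℝ :=
  ∫ p : E × E, (v p.1 - v p.2) * (w p.1 - w p.2) * k ‖p.1 - p.2‖

variable {k : ℝ → ℝ} {v φ : E → ℝ}

theorem IsLevyKernel.measurable_norm_sub (hk : IsLevyKernel E k) :
    Measurable fun p : E × E => k ‖p.1 - p.2‖ :=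
  hk.measurable.comp (by fun_prop)

theorem HasEnergy.integrable_mul (hk : IsLevyKernel E k) (hv : HasEnergy k v) (hφ : HasEnergy k φ)
    (mv : Measurable v) (mφ : Measurable φ) :
    Integrable fun p : E × E => (v p.1 - v p.2) * (φ p.1 - φ p.2) * k ‖p.1 - p.2‖ := by
  have hm := hk.measurable_norm_sub
  refine (Integrable.add hv hφ).mono' (Measurable.mul (by fun_prop) hm).aestronglyMeasurable
    (ae_of_all _ fun p => ?_)
  simp only [Pi.add_apply]
  rw [norm_mul, Real.norm_of_nonneg (hk.nonneg _), Real.norm_eq_abs, ← add_mul]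
  refine mul_le_mul_of_nonneg_right ?_ (hk.nonneg _)
  rw [abs_le]
  constructor <;> nlinarith [sq_nonneg (v p.1 - v p.2 - (φ p.1 - φ p.2)),
    sq_nonneg (v p.1 - v p.2 + (φ p.1 - φ p.2)), sq_nonneg (v p.1 - v p.2),
    sq_nonneg (φ p.1 - φ p.2)]

theorem HasEnergy.sub (hk : IsLevyKernel E k) (hv : HasEnergy k v) (hφ : HasEnergy k φ)
    (mv : Measurable v) (mφ : Measurable φ) : HasEnergy k fun x => v x - φ x := by
  have := (Integrable.add hv hφ).sub ((hv.integrable_mul hk hφ mv mφ).const_mul 2)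
  refine this.congr (ae_of_all _ fun p => ?_)
  simp only [Pi.add_apply, Pi.sub_apply]
  ring

theorem HasEnergy.const_mul (hv : HasEnergy k v) (c : ℝ) : HasEnergy k fun x => c * v x := by
  refine (Integrable.const_mul hv (c ^ 2)).congr (ae_of_all _ fun p => ?_)
  ring

theorem energyForm_sub_left (hk : IsLevyKernel E k) {v₁ v₂ : E → ℝ} (h₁ : HasEnergy k v₁)
    (h₂ : HasEnergy k v₂) (hφ : HasEnergy k φ) (m₁ : Measurable v₁) (m₂ : Measurable v₂)
    (mφ : Measurable φ) :
    energyForm k (fun x => v₁ x - v₂ x) φ = energyForm k v₁ φ - energyForm k v₂ φ := by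
  rw [energyForm, energyForm, energyForm,
    ← integral_sub (h₁.integrable_mul hk hφ m₁ mφ) (h₂.integrable_mul hk hφ m₂ mφ)]
  congr 1 with p
  ring

theorem energyForm_const_mul_left (c : ℝ) (v φ : E → ℝ) :
    energyForm k (fun x => c * v x) φ = c * energyForm k v φ := by
  rw [energyForm, energyForm, ← integral_const_mul]
  congr 1 with p
  ring

theorem energyForm_self_nonneg (hk : IsLevyKernel E k) (v : E → ℝ) : 0 ≤ energyForm k v v :=
  integral_nonneg fun _ => mul_nonneg (mul_self_nonneg _) (hk.nonneg _)

/-- A linear isometry acting on both variables preserves the measure of `E × E`. -/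
theorem measurePreserving_prodMap_isometry (Q R : E ≃ₗᵢ[ℝ] E) :
    MeasurePreserving (fun p : E × E => (Q p.1, R p.2)) volume volume :=
  Q.measurePreserving.prod R.measurePreserving

theorem measurableEmbedding_prodMap_isometry (Q R : E ≃ₗᵢ[ℝ] E) :
    MeasurableEmbedding (fun p : E × E => (Q p.1, R p.2)) :=
  (Q.toHomeomorph.prodCongr R.toHomeomorph).measurableEmbedding

theorem integrable_comp_isometry_prod {F : E × E → ℝ} (hF : Integrable F) (Q R : E ≃ₗᵢ[ℝ] E) :
    Integrable fun p : E × E => F (Q p.1, R p.2) :=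
  (measurePreserving_prodMap_isometry Q R).integrable_comp_of_integrable hF

theorem integral_comp_isometry_prod (F : E × E → ℝ) (Q R : E ≃ₗᵢ[ℝ] E) :
    ∫ p : E × E, F (Q p.1, R p.2) = ∫ p, F p :=
  (measurePreserving_prodMap_isometry Q R).integral_comp
    (measurableEmbedding_prodMap_isometry Q R) F

theorem HasEnergy.comp_isometry (hv : HasEnergy k v) (Q : E ≃ₗᵢ[ℝ] E) :
    HasEnergy k fun x => v (Q x) := by
  refine (integrable_comp_isometry_prod hv Q Q).congr (ae_of_all _ fun p => ?_)
  simp only [← map_sub, LinearIsometryEquiv.norm_map]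

theorem energyForm_comp_isometry (v φ : E → ℝ) (Q : E ≃ₗᵢ[ℝ] E) :
    energyForm k (fun x => v (Q x)) (fun x => φ (Q x)) = energyForm k v φ := by
  rw [energyForm, energyForm, ← integral_comp_isometry_prod
    (fun p : E × E => (v p.1 - v p.2) * (φ p.1 - φ p.2) * k ‖p.1 - p.2‖) Q Q]
  simp only [← map_sub, LinearIsometryEquiv.norm_map]

/-- Averaging over the reflection in each variable: an integral over `E × E` is nonpositive as soon
as the sum over the four reflected points is nonpositive for points of the closed half-space. -/
theorem integral_nonpos_of_sum_hypRefl_nonpos {F : E × E → ℝ} (hF : Integrable F) (w : E)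
    (h : ∀ x y, 0 ≤ inner ℝ x w → 0 ≤ inner ℝ y w →
      F (x, y) + F (x, hypRefl w y) + F (hypRefl w x, y) + F (hypRefl w x, hypRefl w y) ≤ 0) :
    ∫ p, F p ≤ 0 := by
  have h' : ∀ x y, F (x, y) + F (x, hypRefl w y) + F (hypRefl w x, y)
      + F (hypRefl w x, hypRefl w y) ≤ 0 := by
    intro x y
    rcases le_total 0 (inner ℝ x w) with hx | hx <;> rcases le_total 0 (inner ℝ y w) with hy | hy
    · exact h x y hx hy
    · have := h x (hypRefl w y) hx (by simpa using hy)
      simp only [hypRefl_hypRefl] at this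
      linarith
    · have := h (hypRefl w x) y (by simpa using hx) hy
      simp only [hypRefl_hypRefl] at this
      linarith
    · have := h (hypRefl w x) (hypRefl w y) (by simpa using hx) (by simpa using hy)
      simp only [hypRefl_hypRefl] at this
      linarith
  have i2 := integrable_comp_isometry_prod hF (LinearIsometryEquiv.refl ℝ E) (hypRefl w)
  have i3 := integrable_comp_isometry_prod hF (hypRefl w) (LinearIsometryEquiv.refl ℝ E)
  have i4 := integrable_comp_isometry_prod hF (hypRefl w) (hypRefl w)
  have e2 := integral_comp_isometry_prod F (LinearIsometryEquiv.refl ℝ E) (hypRefl w)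
  have e3 := integral_comp_isometry_prod F (hypRefl w) (LinearIsometryEquiv.refl ℝ E)
  have e4 := integral_comp_isometry_prod F (hypRefl w) (hypRefl w)
  simp only [LinearIsometryEquiv.coe_refl, id_eq] at i2 i3 e2 e3
  have hsum : ∫ p : E × E, (((F + fun p : E × E => F (p.1, hypRefl w p.2)) +
      fun p : E × E => F (hypRefl w p.1, p.2)) + fun p : E × E => F (hypRefl w p.1, hypRefl w p.2)) p ≤ 0 :=
    integral_nonpos fun p => h' p.1 p.2
  rw [integral_add' ((hF.add i2).add i3) i4, integral_add' (hF.add i2) i3, integral_add' hF i2,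
    e2, e3, e4] at hsum
  linarith

theorem measurable_halfNegPart (w : E) (hv : Measurable v) : Measurable (halfNegPart w v) := by
  refine Measurable.ite ?_ (by fun_prop) measurable_const
  exact measurableSet_lt measurable_const (by fun_prop)

theorem halfNegPart_sq_mul_le (hk : IsLevyKernel E k) {w : E}
    (hv : ∀ x, v (hypRefl w x) = - v x) {x y : E} (hx : 0 < inner ℝ x w)
    (hy : inner ℝ y w ≤ 0) :
    max (-v x) 0 ^ 2 * k ‖x - y‖ ≤ (v x - v y) ^ 2 * k ‖x - y‖
      + (v x - v (hypRefl w y)) ^ 2 * k ‖x - hypRefl w y‖ := by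
  have n1 := hk.nonneg ‖x - y‖
  have n2 := hk.nonneg ‖x - hypRefl w y‖
  have m1 : 0 ≤ (v x - v y) ^ 2 * k ‖x - y‖ := by positivity
  have m2 : 0 ≤ (v x - v (hypRefl w y)) ^ 2 * k ‖x - hypRefl w y‖ := by positivity
  rcases le_or_gt 0 (v x) with h | h
  · rw [max_eq_right (by linarith)]
    simpa using add_nonneg m1 m2
  rw [max_eq_left (by linarith)]
  rcases le_or_gt 0 (v y) with h' | h'
  · have : (-v x) ^ 2 ≤ (v x - v y) ^ 2 := by nlinarith
    nlinarith [mul_le_mul_of_nonneg_right this n1]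
  · have h1 : (-v x) ^ 2 ≤ (v x - v (hypRefl w y)) ^ 2 := by rw [hv]; nlinarith
    have hne : x ≠ hypRefl w y := by
      rintro rfl
      rw [hv] at h
      linarith
    have hle : ‖x - hypRefl w y‖ ≤ ‖x - y‖ := by
      simpa using norm_sub_le_norm_sub_hypRefl (w := w) (x := x) (y := hypRefl w y) hx.le
        (by simpa using hy)
    have hpos : 0 < ‖x - hypRefl w y‖ := norm_pos_iff.2 (sub_ne_zero.2 hne)
    have h2 : k ‖x - y‖ ≤ k ‖x - hypRefl w y‖ := hk.antitone hpos (hpos.trans_le hle) hle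
    have := mul_le_mul h1 h2 n1 (sq_nonneg _)
    linarith

/-- Truncating an antisymmetric function of finite energy to its negative part on the half-space
keeps the energy finite, although the indicator of the half-space itself may have infinite energy:
the jump at the hyperplane is controlled by comparing `y` with its mirror image. -/
theorem HasEnergy.hasEnergy_halfNegPart (hk : IsLevyKernel E k) {w : E} (he : HasEnergy k v)
    (mv : Measurable v) (hv : ∀ x, v (hypRefl w x) = - v x) :
    HasEnergy k (halfNegPart w v) := by
  have hm := hk.measurable_norm_sub
  have mφ := measurable_halfNegPart w mv
  have i2 := integrable_comp_isometry_prod he (LinearIsometryEquiv.refl ℝ E) (hypRefl w)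
  have i3 := integrable_comp_isometry_prod he (hypRefl w) (LinearIsometryEquiv.refl ℝ E)
  simp only [LinearIsometryEquiv.coe_refl, id_eq] at i2 i3
  refine ((Integrable.add he i2).add i3).mono' (Measurable.mul (by fun_prop) hm).aestronglyMeasurable
    (ae_of_all _ fun p => ?_)
  obtain ⟨x, y⟩ := p
  simp only [Pi.add_apply]
  rw [Real.norm_of_nonneg (mul_nonneg (sq_nonneg _) (hk.nonneg _))]
  have n1 : 0 ≤ (v x - v y) ^ 2 * k ‖x - y‖ := mul_nonneg (sq_nonneg _) (hk.nonneg _)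
  have n2 : 0 ≤ (v x - v (hypRefl w y)) ^ 2 * k ‖x - hypRefl w y‖ :=
    mul_nonneg (sq_nonneg _) (hk.nonneg _)
  have n3 : 0 ≤ (v (hypRefl w x) - v y) ^ 2 * k ‖hypRefl w x - y‖ :=
    mul_nonneg (sq_nonneg _) (hk.nonneg _)
  rcases lt_or_ge 0 (inner ℝ x w) with hx | hx <;> rcases lt_or_ge 0 (inner ℝ y w) with hy | hy
  · rw [halfNegPart_of_pos hx, halfNegPart_of_pos hy]
    have : (max (-v x) 0 - max (-v y) 0) ^ 2 ≤ (v x - v y) ^ 2 := by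
      rw [sq_le_sq]
      refine (abs_max_sub_max_le_abs _ _ _).trans_eq ?_
      rw [neg_sub_neg, abs_sub_comm]
    have := mul_le_mul_of_nonneg_right this (hk.nonneg ‖x - y‖)
    linarith
  · rw [halfNegPart_of_pos hx, halfNegPart_of_nonpos hy, sub_zero]
    have := halfNegPart_sq_mul_le hk hv hx hy
    linarith
  · rw [halfNegPart_of_nonpos hx, halfNegPart_of_pos hy, zero_sub, neg_sq]
    have := halfNegPart_sq_mul_le hk hv hy hx
    rw [norm_sub_rev y x, norm_sub_rev y (hypRefl w x)] at this
    nlinarith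
  · rw [halfNegPart_of_nonpos hx, halfNegPart_of_nonpos hy, sub_zero]
    simp only [ne_eq, OfNat.ofNat_ne_zero, not_false_eq_true, zero_pow, zero_mul]
    linarith

/-- The basic inequality for an antisymmetric function `v` and the test function
`φ = halfNegPart w v`. The last term is the gain from the set where `v ≥ m ≥ 0` on the half-space:
there the kernel is larger than the reflected kernel. -/
theorem energyForm_halfNegPart_le (hk : IsLevyKernel E k) {w : E} (he : HasEnergy k v)
    (mv : Measurable v) (hv : ∀ x, v (hypRefl w x) = - v x) {m : E → ℝ}
    (hm0 : ∀ x, 0 ≤ m x) (hm : ∀ x, m x ≤ max (v x) 0) (hmw : ∀ x, inner ℝ x w ≤ 0 → m x = 0)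
    (hint : Integrable fun p : E × E =>
      halfNegPart w v p.1 * (m p.2 * (k ‖p.1 - p.2‖ - k ‖p.1 - hypRefl w p.2‖))) :
    energyForm k v (halfNegPart w v) + energyForm k (halfNegPart w v) (halfNegPart w v)
      + 2 * ∫ p : E × E,
        halfNegPart w v p.1 * (m p.2 * (k ‖p.1 - p.2‖ - k ‖p.1 - hypRefl w p.2‖)) ≤ 0 := by
  have mφ := measurable_halfNegPart w mv
  have eφ := he.hasEnergy_halfNegPart hk mv hv
  have i1 := he.integrable_mul hk eφ mv mφ
  have i2 := eφ.integrable_mul hk eφ mφ mφ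
  have e4 : ∫ p : E × E, halfNegPart w v p.2 * (m p.1 *
      (k ‖p.2 - p.1‖ - k ‖p.2 - hypRefl w p.1‖)) = ∫ p : E × E,
        halfNegPart w v p.1 * (m p.2 * (k ‖p.1 - p.2‖ - k ‖p.1 - hypRefl w p.2‖)) :=
    integral_prod_swap (μ := (volume : Measure E)) (ν := (volume : Measure E))
      (fun p : E × E => halfNegPart w v p.1 *
        (m p.2 * (k ‖p.1 - p.2‖ - k ‖p.1 - hypRefl w p.2‖)))
  have i4 : Integrable fun p : E × E => halfNegPart w v p.2 * (m p.1 *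
      (k ‖p.2 - p.1‖ - k ‖p.2 - hypRefl w p.1‖)) := hint.swap
  have hcomb := integral_nonpos_of_sum_hypRefl_nonpos (((i1.add i2).add hint).add i4) w ?_
  · rw [integral_add' ((i1.add i2).add hint) i4, integral_add' (i1.add i2) hint,
      integral_add' i1 i2, e4] at hcomb
    rw [energyForm, energyForm]
    linarith
  intro x y hx hy
  have hφ : ∀ z, 0 ≤ inner ℝ z w → halfNegPart w v z = max (-v z) 0 := by
    intro z hz
    rcases hz.eq_or_lt with h | h
    · have h1 : v z = 0 := by
        have := hv z
        rw [hypRefl_eq_self h.symm] at this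
        linarith
      rw [halfNegPart_of_nonpos h.symm.le, h1]
      simp
    · exact halfNegPart_of_pos h
  have hφQ : ∀ z, 0 ≤ inner ℝ z w → halfNegPart w v (hypRefl w z) = 0 := fun z hz =>
    halfNegPart_of_nonpos (by simpa using hz)
  have hmQ : ∀ z, 0 ≤ inner ℝ z w → m (hypRefl w z) = 0 := fun z hz =>
    hmw _ (by simpa using hz)
  have r1 : ‖hypRefl w y - hypRefl w x‖ = ‖x - y‖ := by
    rw [norm_hypRefl_sub_hypRefl, norm_sub_rev]
  have r2 : ‖y - hypRefl w x‖ = ‖x - hypRefl w y‖ := by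
    rw [norm_sub_rev, norm_hypRefl_sub]
  simp only [Pi.add_apply, hφ x hx, hφ y hy, hφQ x hx, hφQ y hy, hmQ x hx, hmQ y hy, hv,
    norm_hypRefl_sub, hypRefl_hypRefl, zero_mul, mul_zero, r2,
    norm_sub_rev y x]
  have hk12 : x = y ∨ k ‖x - hypRefl w y‖ ≤ k ‖x - y‖ := by
    rcases eq_or_ne x y with h | h
    · exact Or.inl h
    · have hpos : 0 < ‖x - y‖ := norm_pos_iff.2 (sub_ne_zero.2 h)
      have hle := norm_sub_le_norm_sub_hypRefl hx hy
      exact Or.inr (hk.antitone hpos (hpos.trans_le hle) hle)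
  have n1 := hk.nonneg ‖x - y‖
  have n2 := hk.nonneg ‖x - hypRefl w y‖
  have hmx := hm x
  have hmy := hm y
  have hm0x := hm0 x
  have hm0y := hm0 y
  generalize k ‖x - y‖ = k₁ at *
  generalize k ‖x - hypRefl w y‖ = k₂ at *
  -- the decomposition of `v` into positive and negative parts
  obtain ⟨A, hA⟩ : ∃ A, A = max (v x) 0 := ⟨_, rfl⟩
  obtain ⟨B, hB⟩ : ∃ B, B = max (v y) 0 := ⟨_, rfl⟩
  obtain ⟨a, ha⟩ : ∃ a, a = max (-v x) 0 := ⟨_, rfl⟩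
  obtain ⟨b, hb⟩ : ∃ b, b = max (-v y) 0 := ⟨_, rfl⟩
  have hA0 : 0 ≤ A := hA ▸ le_max_right _ _
  have hB0 : 0 ≤ B := hB ▸ le_max_right _ _
  have ha0 : 0 ≤ a := ha ▸ le_max_right _ _
  have hb0 : 0 ≤ b := hb ▸ le_max_right _ _
  have hx' : v x = A - a := by
    rw [hA, ha]
    rcases le_total (v x) 0 with h | h
    · rw [max_eq_right h, max_eq_left (by linarith)]; ring
    · rw [max_eq_left h, max_eq_right (by linarith)]; ring
  have hy' : v y = B - b := by
    rw [hB, hb]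
    rcases le_total (v y) 0 with h | h
    · rw [max_eq_right h, max_eq_left (by linarith)]; ring
    · rw [max_eq_left h, max_eq_right (by linarith)]; ring
  have hAa : A * a = 0 := by
    rw [hA, ha]
    rcases le_total (v x) 0 with h | h
    · rw [max_eq_right h, zero_mul]
    · rw [max_eq_right (b := (0 : ℝ)) (a := -v x) (by linarith), mul_zero]
  have hBb : B * b = 0 := by
    rw [hB, hb]
    rcases le_total (v y) 0 with h | h
    · rw [max_eq_right h, zero_mul]
    · rw [max_eq_right (b := (0 : ℝ)) (a := -v y) (by linarith), mul_zero]
  rw [← hA] at hmx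
  rw [← hB] at hmy
  have key : k₁ * (a * (m y - B) + b * (m x - A)) + k₂ * (a * (B - m y) + b * (A - m x))
      - k₂ * (2 * (a * b)) ≤ 0 := by
    have hab : 0 ≤ a * b := mul_nonneg ha0 hb0
    have p1 : 0 ≤ a * (B - m y) := mul_nonneg ha0 (by linarith)
    have p2 : 0 ≤ b * (A - m x) := mul_nonneg hb0 (by linarith)
    rcases hk12 with h | h
    · subst h
      have q1 : a * (B - m x) = 0 := by
        have : A = B := by rw [hA, hB]
        subst this
        have : a * m x ≤ a * A := mul_le_mul_of_nonneg_left hmx ha0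
        have : 0 ≤ a * m x := mul_nonneg ha0 hm0x
        linarith
      have q2 : b * (A - m x) = 0 := by
        have : A = B := by rw [hA, hB]
        subst this
        have : b * m x ≤ b * A := mul_le_mul_of_nonneg_left hmx hb0
        have : 0 ≤ b * m x := mul_nonneg hb0 hm0x
        linarith
      have : k₁ * (a * (m x - B) + b * (m x - A)) = 0 := by
        linear_combination (-k₁) * (q1 + q2)
      rw [this, q1, q2]
      have : 0 ≤ k₂ * (2 * (a * b)) := by positivity
      linarith
    · have := mul_nonneg (sub_nonneg.2 h) (add_nonneg p1 p2)
      have : 0 ≤ k₂ * (2 * (a * b)) := by positivity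
      linarith
  rw [← ha, ← hb, hx', hy']
  refine le_trans (le_of_eq ?_) key
  linear_combination (2 * k₁ + 2 * k₂ - k₁ - k₂) * (hAa + hBb)

end Energy

/-! ### Kernels in polar coordinates, and coercivity on sets of small measure -/

section Kernel

theorem KernelCondition.isLevyKernel {N : ℕ} (hN : 2 ≤ N) {k : ℝ → ℝ} (hk : KernelCondition N k) :
    IsLevyKernel (EuclideanSpace ℝ (Fin N)) ((Ioi 0).indicator k) := by
  have : Nonempty (Fin N) := ⟨⟨0, by omega⟩⟩
  have hmeas : Measurable ((Ioi (0 : ℝ)).indicator k) := by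
    refine measurable_of_restrict_of_restrict_compl (s := Ioi (0 : ℝ)) measurableSet_Ioi ?_ ?_
    · have : Antitone ((Ioi (0 : ℝ)).domRestrict ((Ioi (0 : ℝ)).indicator k)) := by
        intro a b hab
        have ha : (a : ℝ) ∈ Ioi (0 : ℝ) := a.2
        have hb : (b : ℝ) ∈ Ioi (0 : ℝ) := b.2
        simp only [domRestrict_apply, indicator_of_mem ha, indicator_of_mem hb]
        exact hk.antitone ha hb hab
      exact this.measurable
    · have : (Ioi (0 : ℝ))ᶜ.domRestrict ((Ioi (0 : ℝ)).indicator k) = fun _ => 0 := by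
        ext a
        have ha : (a : ℝ) ∉ Ioi (0 : ℝ) := a.2
        simp only [domRestrict_apply, indicator_of_notMem ha]
      rw [this]
      exact measurable_const
  have hnonneg : ∀ r, 0 ≤ (Ioi (0 : ℝ)).indicator k r := fun r =>
    indicator_nonneg (fun r hr => hk.nonneg r hr) r
  have hpolar : ∀ g : ℝ → ℝ, Measurable g → (∀ r, 0 ≤ g r) →
      (Integrable (fun z : EuclideanSpace ℝ (Fin N) => g ‖z‖) ↔
        ∫⁻ r in Ioi (0 : ℝ), ENNReal.ofReal (g r * r ^ (N - 1)) < ⊤) := by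
    intro g mg hg
    rw [integrable_fun_norm_addHaar, IntegrableOn, Integrable]
    simp only [finrank_euclideanSpace, Fintype.card_fin, smul_eq_mul]
    rw [hasFiniteIntegral_iff_norm, and_iff_right (Measurable.aestronglyMeasurable (by fun_prop))]
    rw [setLIntegral_congr_fun measurableSet_Ioi]
    intro r hr
    simp only
    rw [Real.norm_of_nonneg (mul_nonneg (pow_nonneg (le_of_lt hr) _) (hg r)), mul_comm]
  refine ⟨hmeas, hnonneg, by simp, ?_, ?_, ?_⟩
  · intro a ha b hb hab
    simpa only [indicator_of_mem ha, indicator_of_mem hb] using hk.antitone ha hb hab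
  · rw [hpolar (fun r => min 1 (r ^ 2) * (Ioi (0 : ℝ)).indicator k r) (by fun_prop)
      (fun r => mul_nonneg (by positivity) (hnonneg r))]
    refine lt_of_eq_of_lt ?_ hk.levy
    refine setLIntegral_congr_fun measurableSet_Ioi fun r hr => ?_
    simp only [indicator_of_mem hr]
  · rw [hpolar _ hmeas hnonneg, not_lt, top_le_iff, ← hk.singular]
    refine setLIntegral_congr_fun measurableSet_Ioi fun r hr => ?_
    simp only [indicator_of_mem hr]

variable {E : Type*} [NormedAddCommGroup E] [InnerProductSpace ℝ E] [FiniteDimensional ℝ E]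
  [MeasurableSpace E] [BorelSpace E] {k : ℝ → ℝ}

/-- As the kernel is not integrable, its truncations have arbitrarily large mass. -/
theorem IsLevyKernel.exists_truncation_mass (hk : IsLevyKernel E k) {M : ENNReal} (hM : M < ⊤) :
    ∃ ε : ℝ, 0 < ε ∧ M < ∫⁻ z : E, ENNReal.ofReal ((Ioi ε).indicator k ‖z‖) := by
  have mk := hk.measurable
  have htop : ∫⁻ z : E, ENNReal.ofReal (k ‖z‖) = ⊤ := by
    by_contra h
    refine hk.singular ⟨(mk.comp measurable_norm).aestronglyMeasurable, ?_⟩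
    rw [hasFiniteIntegral_iff_ofReal (ae_of_all _ fun z => hk.nonneg _)]
    exact lt_top_iff_ne_top.2 h
  have hsup : ∀ z : E, ENNReal.ofReal (k ‖z‖) =
      ⨆ n : ℕ, ENNReal.ofReal ((Ioi (1 / ((n : ℝ) + 1))).indicator k ‖z‖) := by
    intro z
    refine le_antisymm ?_ (iSup_le fun n => ENNReal.ofReal_le_ofReal
      (indicator_le_self' (fun _ _ => hk.nonneg _) _))
    rcases eq_or_ne z 0 with rfl | hz
    · simp [hk.map_zero]
    · obtain ⟨n, hn⟩ := exists_nat_one_div_lt (norm_pos_iff.2 hz)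
      refine le_trans (le_of_eq ?_) (le_iSup _ n)
      rw [indicator_of_mem (by exact hn)]
  have hmono : Monotone fun (n : ℕ) (z : E) =>
      ENNReal.ofReal ((Ioi (1 / ((n : ℝ) + 1))).indicator k ‖z‖) := by
    intro m n hmn z
    refine ENNReal.ofReal_le_ofReal (indicator_le_indicator_of_subset ?_ (fun _ => hk.nonneg _) _)
    exact Ioi_subset_Ioi (Nat.one_div_le_one_div hmn)
  simp_rw [hsup] at htop
  rw [lintegral_iSup (fun n => by
    exact ((mk.indicator measurableSet_Ioi).comp measurable_norm).ennreal_ofReal) hmono] at htop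
  obtain ⟨n, hn⟩ := iSup_eq_top.1 htop M hM
  exact ⟨1 / ((n : ℝ) + 1), by positivity, hn⟩

/-- The mass of the kernel seen from a point outside a set of small measure is large. -/
theorem IsLevyKernel.exists_le_lintegral_compl (hk : IsLevyKernel E k) {M : ENNReal}
    (hM : M < ⊤) : ∃ δ : ℝ, 0 < δ ∧ ∀ U : Set E, MeasurableSet U → volume U ≤ ENNReal.ofReal δ →
      ∀ x : E, M ≤ ∫⁻ y in Uᶜ, ENNReal.ofReal (k ‖x - y‖) := by
  obtain ⟨ε, hε, hmass⟩ := hk.exists_truncation_mass (M := M + 1) (by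
    exact ENNReal.add_lt_top.2 ⟨hM, ENNReal.one_lt_top⟩)
  have hkε := hk.nonneg ε
  refine ⟨1 / (k ε + 1), by positivity, fun U hU hvol x => ?_⟩
  have h1 : ∫⁻ z : E, ENNReal.ofReal ((Ioi ε).indicator k ‖z‖) =
      ∫⁻ y : E, ENNReal.ofReal ((Ioi ε).indicator k ‖x - y‖) :=
    (lintegral_sub_left_eq_self (fun z : E => ENNReal.ofReal ((Ioi ε).indicator k ‖z‖)) x).symm
  rw [h1, ← lintegral_add_compl _ hU] at hmass
  have h2 : ∫⁻ y in U, ENNReal.ofReal ((Ioi ε).indicator k ‖x - y‖) ≤ 1 := by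
    calc ∫⁻ y in U, ENNReal.ofReal ((Ioi ε).indicator k ‖x - y‖)
        ≤ ∫⁻ _ in U, ENNReal.ofReal (k ε) := by
          refine lintegral_mono fun y => ENNReal.ofReal_le_ofReal ?_
          by_cases h : ‖x - y‖ ∈ Ioi ε
          · rw [indicator_of_mem h]
            exact hk.antitone hε (hε.trans h) (le_of_lt h)
          · rw [indicator_of_notMem h]
            exact hkε
      _ = ENNReal.ofReal (k ε) * volume U := by rw [setLIntegral_const]
      _ ≤ ENNReal.ofReal (k ε) * ENNReal.ofReal (1 / (k ε + 1)) := by gcongr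
      _ ≤ 1 := by
          rw [← ENNReal.ofReal_mul hkε, ← ENNReal.ofReal_one]
          refine ENNReal.ofReal_le_ofReal ?_
          rw [mul_one_div, div_le_one (by positivity)]
          linarith
  have h3 : ∫⁻ y in Uᶜ, ENNReal.ofReal ((Ioi ε).indicator k ‖x - y‖) ≤
      ∫⁻ y in Uᶜ, ENNReal.ofReal (k ‖x - y‖) :=
    lintegral_mono fun y => ENNReal.ofReal_le_ofReal
      (indicator_le_self' (fun _ _ => hk.nonneg _) _)
  have h4 := hmass.le.trans (add_le_add h2 h3)
  rw [add_comm] at h4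
  exact (ENNReal.add_le_add_iff_left ENNReal.one_ne_top).1 h4

/-- A Poincaré inequality whose constant blows up as the measure of the support shrinks. -/
theorem IsLevyKernel.exists_volume_poincare (hk : IsLevyKernel E k) (κ : ℝ) :
    ∃ δ : ℝ, 0 < δ ∧ ∀ U : Set E, MeasurableSet U → volume U ≤ ENNReal.ofReal δ →
      ∀ φ : E → ℝ, Measurable φ → HasEnergy k φ → (∀ x, x ∉ U → φ x = 0) →
        κ * ∫ x, φ x ^ 2 ≤ energyForm k φ φ := by
  obtain ⟨δ, hδ, h⟩ := hk.exists_le_lintegral_compl (M := ENNReal.ofReal κ) ENNReal.ofReal_lt_top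
  refine ⟨δ, hδ, fun U hU hvol φ mφ eφ hφ => ?_⟩
  have mk := hk.measurable
  have mkp := hk.measurable_norm_sub
  have hne : ∀ p : E × E, 0 ≤ (φ p.1 - φ p.2) ^ 2 * k ‖p.1 - p.2‖ := fun p =>
    mul_nonneg (sq_nonneg _) (hk.nonneg _)
  have hE : ENNReal.ofReal (energyForm k φ φ) =
      ∫⁻ p : E × E, ENNReal.ofReal ((φ p.1 - φ p.2) ^ 2 * k ‖p.1 - p.2‖) := by
    rw [← ofReal_integral_eq_lintegral_ofReal eφ (ae_of_all _ hne), energyForm]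
    simp only [sq]
  have mF : Measurable fun p : E × E => ENNReal.ofReal ((φ p.1 - φ p.2) ^ 2 * k ‖p.1 - p.2‖) :=
    (Measurable.mul (by fun_prop) mkp).ennreal_ofReal
  have hle : ENNReal.ofReal κ * ∫⁻ x, ENNReal.ofReal (φ x ^ 2) ≤
      ENNReal.ofReal (energyForm k φ φ) := by
    rw [hE, Measure.volume_eq_prod, lintegral_prod _ mF.aemeasurable,
      ← lintegral_const_mul' _ _ ENNReal.ofReal_ne_top]
    refine lintegral_mono fun x => ?_
    calc ENNReal.ofReal κ * ENNReal.ofReal (φ x ^ 2)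
        ≤ (∫⁻ y in Uᶜ, ENNReal.ofReal (k ‖x - y‖)) * ENNReal.ofReal (φ x ^ 2) := by
          gcongr
          exact h U hU hvol x
      _ = ∫⁻ y in Uᶜ, ENNReal.ofReal (k ‖x - y‖) * ENNReal.ofReal (φ x ^ 2) := by
          rw [lintegral_mul_const' _ _ ENNReal.ofReal_ne_top]
      _ = ∫⁻ y in Uᶜ, ENNReal.ofReal ((φ x - φ y) ^ 2 * k ‖x - y‖) := by
          refine setLIntegral_congr_fun hU.compl fun y hy => ?_
          simp only [hφ y hy, sub_zero]
          rw [← ENNReal.ofReal_mul (hk.nonneg _), mul_comm]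
      _ ≤ ∫⁻ y, ENNReal.ofReal ((φ x - φ y) ^ 2 * k ‖x - y‖) := setLIntegral_le_lintegral _ _
  rcases le_or_gt κ 0 with hκ | hκ
  · exact (mul_nonpos_of_nonpos_of_nonneg hκ (integral_nonneg fun x => sq_nonneg _)).trans
      (energyForm_self_nonneg hk φ)
  have hfin : ∫⁻ x, ENNReal.ofReal (φ x ^ 2) < ⊤ := by
    by_contra hcon
    rw [not_lt, top_le_iff] at hcon
    rw [hcon, ENNReal.mul_top (by simpa using hκ), top_le_iff] at hle
    exact ENNReal.ofReal_ne_top hle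
  have hint : Integrable fun x => φ x ^ 2 := by
    refine ⟨(mφ.pow_const 2).aestronglyMeasurable, ?_⟩
    rwa [hasFiniteIntegral_iff_ofReal (ae_of_all _ fun x => sq_nonneg _)]
  rw [← ofReal_integral_eq_lintegral_ofReal hint (ae_of_all _ fun x => sq_nonneg _),
    ← ENNReal.ofReal_mul hκ.le] at hle
  exact (ENNReal.ofReal_le_ofReal_iff (energyForm_self_nonneg hk φ)).1 hle

end Kernel

/-! ### One-sided bounds of the nonlocal operator on barriers -/

section Paraboloid

variable {E : Type*} [NormedAddCommGroup E]

/-- The paraboloid `r ^ 2 - ‖x - x₀‖ ^ 2`, truncated to zero outside the ball of radius `r`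
about `x₀`. -/
noncomputable def paraboloid (x₀ : E) (r : ℝ) (x : E) : ℝ := r ^ 2 - min ‖x - x₀‖ r ^ 2

variable {x₀ : E} {r : ℝ}

theorem paraboloid_nonneg (hr : 0 ≤ r) (x : E) : 0 ≤ paraboloid x₀ r x := by
  have h1 : 0 ≤ min ‖x - x₀‖ r := le_min (norm_nonneg _) hr
  have h2 := min_le_right ‖x - x₀‖ r
  rw [paraboloid]
  nlinarith

theorem paraboloid_le (x : E) : paraboloid x₀ r x ≤ r ^ 2 := by
  rw [paraboloid]
  nlinarith [sq_nonneg (min ‖x - x₀‖ r)]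

theorem paraboloid_self (hr : 0 ≤ r) : paraboloid x₀ r x₀ = r ^ 2 := by
  simp [paraboloid, hr]

theorem paraboloid_eq_zero {x : E} (h : r ≤ ‖x - x₀‖) : paraboloid x₀ r x = 0 := by
  rw [paraboloid, min_eq_right h, sub_self]

theorem paraboloid_of_lt {x : E} (h : ‖x - x₀‖ < r) :
    paraboloid x₀ r x = r ^ 2 - ‖x - x₀‖ ^ 2 := by
  rw [paraboloid, min_eq_left h.le]

theorem le_paraboloid (hr : 0 ≤ r) (x : E) : r ^ 2 - ‖x - x₀‖ ^ 2 ≤ paraboloid x₀ r x := by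
  rcases lt_or_ge ‖x - x₀‖ r with h | h
  · rw [paraboloid_of_lt h]
  · rw [paraboloid, min_eq_right h]
    nlinarith

theorem continuous_paraboloid : Continuous (paraboloid x₀ r) := by
  unfold paraboloid
  fun_prop

theorem abs_paraboloid_sub_le (hr : 0 ≤ r) (x y : E) :
    |paraboloid x₀ r x - paraboloid x₀ r y| ≤ 2 * r * ‖x - y‖ := by
  have h1 : 0 ≤ min ‖x - x₀‖ r := le_min (norm_nonneg _) hr
  have h2 := min_le_right ‖x - x₀‖ r
  have h3 : 0 ≤ min ‖y - x₀‖ r := le_min (norm_nonneg _) hr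
  have h4 := min_le_right ‖y - x₀‖ r
  have h5 : |min ‖x - x₀‖ r - min ‖y - x₀‖ r| ≤ ‖x - y‖ := by
    refine (abs_min_sub_min_le_max _ _ _ _).trans ?_
    rw [sub_self, abs_zero, max_eq_left (abs_nonneg _)]
    refine (abs_norm_sub_norm_le _ _).trans_eq ?_
    rw [sub_sub_sub_cancel_right]
  have : paraboloid x₀ r x - paraboloid x₀ r y =
      -((min ‖x - x₀‖ r + min ‖y - x₀‖ r) * (min ‖x - x₀‖ r - min ‖y - x₀‖ r)) := by
    rw [paraboloid, paraboloid]
    ring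
  rw [this, abs_neg, abs_mul, abs_of_nonneg (add_nonneg h1 h3)]
  exact mul_le_mul (by linarith) h5 (abs_nonneg _) (by linarith)

end Paraboloid

section Barrier

variable {E : Type*} [NormedAddCommGroup E] [InnerProductSpace ℝ E] {x₀ : E} {r : ℝ}

/-- The second differences of the paraboloid inside its ball; outside, the truncation only lowers
them. -/
theorem two_mul_paraboloid_sub_le (hr : 0 ≤ r) {x : E} (hx : ‖x - x₀‖ < r) (z : E) :
    2 * paraboloid x₀ r x - paraboloid x₀ r (x - z) - paraboloid x₀ r (x + z)
      ≤ 2 * (1 + r ^ 2) * min 1 (‖z‖ ^ 2) := by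
  have h1 : 2 * paraboloid x₀ r x - paraboloid x₀ r (x - z) - paraboloid x₀ r (x + z)
      ≤ 2 * ‖z‖ ^ 2 := by
    have e1 := le_paraboloid (x₀ := x₀) hr (x - z)
    have e2 := le_paraboloid (x₀ := x₀) hr (x + z)
    have e3 := parallelogram_law_with_norm ℝ (x - x₀) z
    rw [show x - x₀ + z = x + z - x₀ by abel, show x - x₀ - z = x - z - x₀ by abel] at e3
    rw [paraboloid_of_lt hx]
    nlinarith
  have h2 : 2 * paraboloid x₀ r x - paraboloid x₀ r (x - z) - paraboloid x₀ r (x + z)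
      ≤ 2 * r ^ 2 := by
    have e1 := paraboloid_nonneg (x₀ := x₀) hr (x - z)
    have e2 := paraboloid_nonneg (x₀ := x₀) hr (x + z)
    have e3 := paraboloid_le (x₀ := x₀) (r := r) x
    linarith
  rcases le_total 1 (‖z‖ ^ 2) with h | h
  · rw [min_eq_left h]
    nlinarith
  · rw [min_eq_right h]
    nlinarith [mul_nonneg (sq_nonneg r) (sq_nonneg ‖z‖)]

/-- The antisymmetric barrier: the paraboloid minus its mirror image. -/
noncomputable def barrier (w x₀ : E) (r : ℝ) (x : E) : ℝ :=
  paraboloid x₀ r x - paraboloid x₀ r (hypRefl w x)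

theorem barrier_hypRefl (w : E) (x : E) : barrier w x₀ r (hypRefl w x) = - barrier w x₀ r x := by
  simp [barrier]

theorem continuous_barrier (w : E) : Continuous (barrier w x₀ r) :=
  continuous_paraboloid.sub (continuous_paraboloid.comp (hypRefl w).continuous)

theorem abs_barrier_le (hr : 0 ≤ r) (w x : E) : |barrier w x₀ r x| ≤ r ^ 2 := by
  have h1 := paraboloid_nonneg (x₀ := x₀) hr x
  have h2 := paraboloid_nonneg (x₀ := x₀) hr (hypRefl w x)
  have h3 := paraboloid_le (x₀ := x₀) (r := r) x
  have h4 := paraboloid_le (x₀ := x₀) (r := r) (hypRefl w x)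
  rw [barrier, abs_le]
  constructor <;> linarith

/-- The mirror image of the paraboloid is far away, hence it contributes to the second differences
only for large increments. -/
theorem two_mul_barrier_sub_le {w : E} (hr : 0 ≤ r) (hrw : 4 * r ≤ ‖x₀ - hypRefl w x₀‖) {x : E}
    (hx : ‖x - x₀‖ < r) (z : E) :
    2 * barrier w x₀ r x - barrier w x₀ r (x - z) - barrier w x₀ r (x + z)
      ≤ 4 * (1 + r ^ 2) * min 1 (‖z‖ ^ 2) := by
  have far : ∀ z : E, paraboloid x₀ r (hypRefl w (x + z)) ≤ (1 + r ^ 2) * min 1 (‖z‖ ^ 2) := by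
    intro z
    rcases le_or_gt r ‖hypRefl w (x + z) - x₀‖ with h | h
    · rw [paraboloid_eq_zero h]
      positivity
    · rw [norm_hypRefl_sub] at h
      have e : x₀ - hypRefl w x₀ = -(x - x₀) + (x + z - hypRefl w x₀) - z := by abel
      have h1 : ‖x₀ - hypRefl w x₀‖ ≤ ‖x - x₀‖ + ‖x + z - hypRefl w x₀‖ + ‖z‖ := by
        rw [e]
        refine (norm_sub_le _ _).trans (add_le_add_left ((norm_add_le _ _).trans ?_) _)
        rw [norm_neg]
      have hz : 2 * r ≤ ‖z‖ := by linarith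
      have h2 := paraboloid_le (x₀ := x₀) (r := r) (hypRefl w (x + z))
      rcases le_total 1 (‖z‖ ^ 2) with h | h
      · rw [min_eq_left h]
        linarith
      · rw [min_eq_right h]
        nlinarith [mul_nonneg (sq_nonneg r) (sq_nonneg ‖z‖)]
  have h1 := two_mul_paraboloid_sub_le hr hx z
  have h2 := far z
  have h3 := far (-z)
  rw [norm_neg, ← sub_eq_add_neg] at h3
  have h4 := paraboloid_nonneg (x₀ := x₀) hr (hypRefl w x)
  simp only [barrier]
  linarith

variable [FiniteDimensional ℝ E] [MeasurableSpace E] [BorelSpace E] {k : ℝ → ℝ}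

theorem integrable_mul_comp_norm_sub {f : E → ℝ} {g : ℝ → ℝ} (hf : Integrable f)
    (hg : Integrable fun z : E => g ‖z‖) :
    Integrable fun p : E × E => f p.1 * g ‖p.1 - p.2‖ := by
  have h := (measurePreserving_prod_sub (volume : Measure E) (volume : Measure E)
    ).integrable_comp_of_integrable (hf.mul_prod hg)
  refine h.congr (ae_of_all _ fun p => ?_)
  simp only [Function.comp_apply, norm_sub_rev p.1]

theorem hasEnergy_paraboloid (hk : IsLevyKernel E k) (hr : 0 ≤ r) :
    HasEnergy k (paraboloid x₀ r) := by
  have mk := hk.measurable_norm_sub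
  have mp : Measurable (paraboloid x₀ r) := continuous_paraboloid.measurable
  set f : E → ℝ := (Metric.ball x₀ r).indicator fun _ => r ^ 4 + 4 * r ^ 2 with hf
  have hf0 : ∀ x, 0 ≤ f x := fun x => indicator_nonneg (fun _ _ => by positivity) x
  have hfi : Integrable f := by
    rw [hf, integrable_indicator_iff measurableSet_ball]
    exact integrableOn_const measure_ball_lt_top.ne
  have h1 := integrable_mul_comp_norm_sub (g := fun s => min 1 (s ^ 2) * k s) hfi hk.levy
  have h2 : Integrable fun p : E × E => f p.2 * (min 1 (‖p.1 - p.2‖ ^ 2) * k ‖p.1 - p.2‖) := by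
    refine h1.swap.congr (ae_of_all _ fun p => ?_)
    simp only [Function.comp_apply, Prod.fst_swap, Prod.snd_swap, norm_sub_rev p.2]
  refine (h1.add h2).mono' (Measurable.mul (by fun_prop) mk).aestronglyMeasurable
    (ae_of_all _ fun p => ?_)
  obtain ⟨x, y⟩ := p
  have hkn := hk.nonneg ‖x - y‖
  simp only [Pi.add_apply]
  rw [Real.norm_of_nonneg (by positivity), ← add_mul, ← mul_assoc]
  refine mul_le_mul_of_nonneg_right ?_ hkn
  by_cases hxy : x ∈ Metric.ball x₀ r ∨ y ∈ Metric.ball x₀ r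
  · have hsum : r ^ 4 + 4 * r ^ 2 ≤ f x + f y := by
      rcases hxy with h | h
      · have : f x = r ^ 4 + 4 * r ^ 2 := indicator_of_mem h _
        linarith [hf0 y]
      · have : f y = r ^ 4 + 4 * r ^ 2 := indicator_of_mem h _
        linarith [hf0 x]
    refine le_trans ?_ (mul_le_mul_of_nonneg_right hsum (by positivity))
    have e1 : (paraboloid x₀ r x - paraboloid x₀ r y) ^ 2 ≤ 4 * r ^ 2 * ‖x - y‖ ^ 2 := by
      have := abs_paraboloid_sub_le (x₀ := x₀) hr x y
      have := mul_self_le_mul_self (abs_nonneg _) this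
      rw [abs_mul_abs_self] at this
      nlinarith
    have e2 : (paraboloid x₀ r x - paraboloid x₀ r y) ^ 2 ≤ r ^ 4 := by
      have h1 := paraboloid_nonneg (x₀ := x₀) hr x
      have h2 := paraboloid_nonneg (x₀ := x₀) hr y
      have h3 := paraboloid_le (x₀ := x₀) (r := r) x
      have h4 := paraboloid_le (x₀ := x₀) (r := r) y
      have : |paraboloid x₀ r x - paraboloid x₀ r y| ≤ r ^ 2 := by
        rw [abs_le]
        constructor <;> linarith
      have := mul_self_le_mul_self (abs_nonneg _) this
      rw [abs_mul_abs_self] at this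
      nlinarith
    rcases le_total 1 (‖x - y‖ ^ 2) with h | h
    · rw [min_eq_left h]
      nlinarith [sq_nonneg r]
    · rw [min_eq_right h]
      nlinarith [mul_nonneg (sq_nonneg (r ^ 2)) (sq_nonneg ‖x - y‖)]
  · push Not at hxy
    have hx : paraboloid x₀ r x = 0 :=
      paraboloid_eq_zero (by simpa [dist_eq_norm] using hxy.1)
    have hy : paraboloid x₀ r y = 0 :=
      paraboloid_eq_zero (by simpa [dist_eq_norm] using hxy.2)
    rw [hx, hy, sub_self, sq, zero_mul]
    have := hf0 x
    have := hf0 y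
    positivity

theorem hasEnergy_barrier (hk : IsLevyKernel E k) (hr : 0 ≤ r) (w : E) :
    HasEnergy k (barrier w x₀ r) :=
  (hasEnergy_paraboloid hk hr).sub hk ((hasEnergy_paraboloid hk hr).comp_isometry (hypRefl w))
    continuous_paraboloid.measurable
    (continuous_paraboloid.comp (hypRefl w).continuous).measurable

theorem IsLevyKernel.integrable_truncation (hk : IsLevyKernel E k) {ε : ℝ} (hε : 0 < ε) :
    Integrable fun z : E => (Ioi ε).indicator k ‖z‖ := by
  have hm : 0 < min 1 (ε ^ 2) := by positivity
  refine (hk.levy.const_mul (min 1 (ε ^ 2))⁻¹).mono'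
    ((hk.measurable.indicator measurableSet_Ioi).comp measurable_norm).aestronglyMeasurable
    (ae_of_all _ fun z => ?_)
  rw [Real.norm_of_nonneg (indicator_nonneg (fun _ _ => hk.nonneg _) _)]
  by_cases h : ‖z‖ ∈ Ioi ε
  · rw [indicator_of_mem h, ← mul_assoc]
    refine le_mul_of_one_le_left (hk.nonneg _) ?_
    rw [inv_mul_eq_div, one_le_div hm]
    have : ε ^ 2 ≤ ‖z‖ ^ 2 := pow_le_pow_left₀ hε.le (le_of_lt h) 2
    exact min_le_min_left _ this
  · rw [indicator_of_notMem h]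
    have := hk.nonneg ‖z‖
    positivity

/-- The bound of `energyForm_le_of_second_difference_le` for a kernel truncated near the diagonal:
there the form splits into absolutely convergent integrals, and averaging over the increments `z`
and `-z` produces the second differences. -/
theorem energyForm_truncation_le (hk : IsLevyKernel E k) {θ φ : E → ℝ} {B C ε : ℝ} (hε : 0 < ε)
    (hC : 0 ≤ C) (mθ : Measurable θ) (hB : ∀ x, |θ x| ≤ B) (hφ0 : ∀ x, 0 ≤ φ x)
    (iφ : Integrable φ)
    (hθ : ∀ x, φ x ≠ 0 → ∀ z, 2 * θ x - θ (x - z) - θ (x + z) ≤ C * min 1 (‖z‖ ^ 2)) :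
    energyForm ((Ioi ε).indicator k) θ φ ≤
      (C * ∫ z : E, min 1 (‖z‖ ^ 2) * k ‖z‖) * ∫ x, φ x := by
  set κ := (Ioi ε).indicator k with hκ
  have iκ : Integrable fun z : E => κ ‖z‖ := hk.integrable_truncation hε
  have hκ0 : ∀ s, 0 ≤ κ s := fun s => indicator_nonneg (fun _ _ => hk.nonneg _) s
  have hκk : ∀ s, κ s ≤ k s := fun s => indicator_le_self' (fun _ _ => hk.nonneg _) s
  have i1 : Integrable fun p : E × E => (θ p.1 - θ p.2) * (φ p.1 * κ ‖p.1 - p.2‖) := by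
    refine (integrable_mul_comp_norm_sub iφ iκ).bdd_mul (c := 2 * B)
      (Measurable.aestronglyMeasurable (by fun_prop)) (ae_of_all _ fun p => ?_)
    rw [Real.norm_eq_abs]
    refine (abs_sub _ _).trans ?_
    linarith [hB p.1, hB p.2]
  have i2 : Integrable fun p : E × E => (θ p.2 - θ p.1) * (φ p.2 * κ ‖p.2 - p.1‖) := i1.swap
  have hsplit : energyForm κ θ φ =
      2 * ∫ p : E × E, (θ p.1 - θ p.2) * (φ p.1 * κ ‖p.1 - p.2‖) := by
    have e : ∫ p : E × E, (θ p.2 - θ p.1) * (φ p.2 * κ ‖p.2 - p.1‖) =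
        ∫ p : E × E, (θ p.1 - θ p.2) * (φ p.1 * κ ‖p.1 - p.2‖) :=
      integral_prod_swap (μ := (volume : Measure E)) (ν := (volume : Measure E))
        (fun p : E × E => (θ p.1 - θ p.2) * (φ p.1 * κ ‖p.1 - p.2‖))
    rw [two_mul]
    nth_rewrite 2 [← e]
    rw [← integral_add i1 i2, energyForm]
    congr 1 with p
    rw [norm_sub_rev p.2]
    ring
  rw [hsplit, Measure.volume_eq_prod, integral_prod _ i1, ← integral_const_mul,
    ← integral_const_mul]
  refine integral_mono (i1.integral_prod_left.const_mul 2) (iφ.const_mul _) fun x => ?_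
  by_cases hx : φ x = 0
  · simp [hx]
  have j1 : Integrable fun z : E => (θ x - θ (x - z)) * κ ‖z‖ := by
    refine iκ.bdd_mul (c := 2 * B) (Measurable.aestronglyMeasurable (by fun_prop))
      (ae_of_all _ fun z => ?_)
    rw [Real.norm_eq_abs]
    refine (abs_sub _ _).trans ?_
    linarith [hB x, hB (x - z)]
  have j2 : Integrable fun z : E => (θ x - θ (x + z)) * κ ‖z‖ := by
    refine iκ.bdd_mul (c := 2 * B) (Measurable.aestronglyMeasurable (by fun_prop))
      (ae_of_all _ fun z => ?_)
    rw [Real.norm_eq_abs]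
    refine (abs_sub _ _).trans ?_
    linarith [hB x, hB (x + z)]
  have e1 : ∫ y, (θ x - θ y) * (φ x * κ ‖x - y‖) = φ x * ∫ z, (θ x - θ (x - z)) * κ ‖z‖ := by
    rw [← integral_const_mul, ← integral_sub_left_eq_self _ _ x]
    congr 1 with y
    rw [sub_sub_cancel]
    ring
  have e2 : ∫ z, (θ x - θ (x + z)) * κ ‖z‖ = ∫ z, (θ x - θ (x - z)) * κ ‖z‖ := by
    rw [← integral_neg_eq_self]
    simp only [norm_neg, ← sub_eq_add_neg]
  have e3 : 2 * ∫ z, (θ x - θ (x - z)) * κ ‖z‖ ≤ C * ∫ z : E, min 1 (‖z‖ ^ 2) * k ‖z‖ := by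
    rw [two_mul]
    nth_rewrite 2 [← e2]
    rw [← integral_add j1 j2, ← integral_const_mul]
    refine integral_mono (j1.add j2) (hk.levy.const_mul C) fun z => ?_
    calc (θ x - θ (x - z)) * κ ‖z‖ + (θ x - θ (x + z)) * κ ‖z‖
        = (2 * θ x - θ (x - z) - θ (x + z)) * κ ‖z‖ := by ring
      _ ≤ (C * min 1 (‖z‖ ^ 2)) * κ ‖z‖ := mul_le_mul_of_nonneg_right (hθ x hx z) (hκ0 _)
      _ ≤ (C * min 1 (‖z‖ ^ 2)) * k ‖z‖ := mul_le_mul_of_nonneg_left (hκk _) (by positivity)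
      _ = C * (min 1 (‖z‖ ^ 2) * k ‖z‖) := by ring
  simp only
  rw [e1]
  calc 2 * (φ x * ∫ z, (θ x - θ (x - z)) * κ ‖z‖)
      = φ x * (2 * ∫ z, (θ x - θ (x - z)) * κ ‖z‖) := by ring
    _ ≤ φ x * (C * ∫ z : E, min 1 (‖z‖ ^ 2) * k ‖z‖) := mul_le_mul_of_nonneg_left e3 (hφ0 x)
    _ = _ := by ring

/-- If the second differences of `θ` are bounded on the support of a nonnegative `φ`, then `θ` is a
weak subsolution against `φ` up to a constant. The bound for truncated kernels passes to the limit
by dominated convergence. -/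
theorem energyForm_le_of_second_difference_le (hk : IsLevyKernel E k) {θ φ : E → ℝ} {B C : ℝ}
    (hC : 0 ≤ C) (mθ : Measurable θ) (eθ : HasEnergy k θ) (hB : ∀ x, |θ x| ≤ B)
    (mφ : Measurable φ) (eφ : HasEnergy k φ) (hφ0 : ∀ x, 0 ≤ φ x) (iφ : Integrable φ)
    (hθ : ∀ x, φ x ≠ 0 → ∀ z, 2 * θ x - θ (x - z) - θ (x + z) ≤ C * min 1 (‖z‖ ^ 2)) :
    energyForm k θ φ ≤ (C * ∫ z : E, min 1 (‖z‖ ^ 2) * k ‖z‖) * ∫ x, φ x := by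
  have hlim : Filter.Tendsto
      (fun n : ℕ => energyForm ((Ioi (1 / ((n : ℝ) + 1))).indicator k) θ φ) Filter.atTop
      (nhds (energyForm k θ φ)) := by
    have i := eθ.integrable_mul hk eφ mθ mφ
    refine tendsto_integral_of_dominated_convergence _ (fun n => ?_) i.norm (fun n => ?_) ?_
    · have : Measurable fun p : E × E => (Ioi (1 / ((n : ℝ) + 1))).indicator k ‖p.1 - p.2‖ :=
        (hk.measurable.indicator measurableSet_Ioi).comp (by fun_prop)
      exact (Measurable.mul (by fun_prop) this).aestronglyMeasurable
    · refine ae_of_all _ fun p => ?_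
      rw [norm_mul, norm_mul _ (k _)]
      refine mul_le_mul_of_nonneg_left ?_ (norm_nonneg _)
      exact norm_indicator_le_norm_self _ _
    · refine ae_of_all _ fun p => ?_
      rcases eq_or_ne p.1 p.2 with h | h
      · simp [h]
      · obtain ⟨n, hn⟩ := exists_nat_one_div_lt (norm_pos_iff.2 (sub_ne_zero.2 h))
        refine tendsto_const_nhds.congr' ?_
        filter_upwards [Filter.eventually_ge_atTop n] with m hm
        rw [indicator_of_mem]
        exact (Nat.one_div_le_one_div hm).trans_lt hn
  exact le_of_tendsto' hlim fun n =>
    energyForm_truncation_le hk (by positivity) hC mθ hB hφ0 iφ hθ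

end Barrier

/-! ### Maximum principles for antisymmetric functions -/

section MaximumPrinciple

variable {E : Type*} [NormedAddCommGroup E] [InnerProductSpace ℝ E] [FiniteDimensional ℝ E]
  [MeasurableSpace E] [BorelSpace E] {k : ℝ → ℝ} {Ω : Set E} {L : ℝ} {w : E} {v : E → ℝ}

/-- An antisymmetric weak supersolution: `v` is odd with respect to the reflection at the hyperplane
orthogonal to `w` and, in the weak sense, `I v ≥ - L |v|` in `Ω`. The factor `2` accounts for
`energyForm` being twice the form `J`. -/
structure IsAntisymmetricSupersolution (k : ℝ → ℝ) (Ω : Set E) (L : ℝ) (w : E) (v : E → ℝ) :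
    Prop where
  measurable : Measurable v
  bounded : ∃ C, ∀ x, |v x| ≤ C
  hasEnergy : HasEnergy k v
  antisymm : ∀ x, v (hypRefl w x) = - v x
  eq_zero : ∀ x, x ∉ Ω → v x = 0
  continuousOn : ContinuousOn v Ω
  ineq : ∀ φ : E → ℝ, Measurable φ → HasEnergy k φ → (∀ x, 0 ≤ φ x) → (∃ C, ∀ x, φ x ≤ C) →
    (∀ x, x ∉ Ω → φ x = 0) → -(2 * L * ∫ x, |v x| * φ x) ≤ energyForm k v φ

theorem integrable_of_bounded_of_eq_zero (hΩ : Bornology.IsBounded Ω) {φ : E → ℝ}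
    (mφ : Measurable φ) {C : ℝ} (hC : ∀ x, |φ x| ≤ C) (h0 : ∀ x, x ∉ Ω → φ x = 0) :
    Integrable φ := by
  obtain ⟨R, hR⟩ := hΩ.subset_closedBall 0
  have hi : Integrable ((Metric.closedBall (0 : E) R).indicator fun _ => C) := by
    rw [integrable_indicator_iff measurableSet_closedBall]
    exact integrableOn_const measure_closedBall_lt_top.ne
  refine hi.mono' mφ.aestronglyMeasurable (ae_of_all _ fun x => ?_)
  by_cases h : x ∈ Metric.closedBall (0 : E) R
  · rw [indicator_of_mem h]
    exact hC x
  · rw [indicator_of_notMem h, h0 x fun hx => h (hR hx), norm_zero]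

theorem nonneg_of_halfNegPart_ae_eq_zero (hΩ : IsOpen Ω) (hv : ContinuousOn v Ω)
    (h : halfNegPart w v =ᵐ[volume] 0) {x : E} (hx : x ∈ Ω) (hxw : 0 < inner ℝ x w) :
    0 ≤ v x := by
  have hopen : IsOpen ((Ω ∩ v ⁻¹' Iio 0) ∩ {x | 0 < inner ℝ x w}) :=
    (hv.isOpen_inter_preimage hΩ isOpen_Iio).inter
      (isOpen_lt continuous_const (by fun_prop))
  have hnull : volume ((Ω ∩ v ⁻¹' Iio 0) ∩ {x | 0 < inner ℝ x w}) = 0 := by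
    refine measure_mono_null ?_ (ae_iff.1 h)
    rintro y ⟨⟨-, hy⟩, hyw⟩
    have hy' : v y < 0 := hy
    have hyw' : 0 < inner ℝ y w := hyw
    simp only [mem_ofPred_eq, Pi.zero_apply, halfNegPart_of_pos hyw']
    rw [max_eq_left (by linarith)]
    linarith
  replace hnull := (IsOpen.measure_eq_zero_iff (volume : Measure E) hopen).1 hnull
  by_contra hneg
  exact (hnull ▸ (⟨⟨hx, not_le.1 hneg⟩, hxw⟩ :
    x ∈ (Ω ∩ v ⁻¹' Iio 0) ∩ {x | 0 < inner ℝ x w}) : x ∈ (∅ : Set E))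

/-- Maximum principle for sets of small measure: it suffices to know that `v ≥ 0` on a part of the
half-space which exhausts `Ω` up to small measure. -/
theorem exists_small_volume_maximum_principle (hk : IsLevyKernel E k) (hΩ : IsOpen Ω)
    (hΩb : Bornology.IsBounded Ω) (L : ℝ) :
    ∃ δ : ℝ, 0 < δ ∧ ∀ (w : E) (v : E → ℝ), IsAntisymmetricSupersolution k Ω L w v →
      ∀ K : Set E, MeasurableSet K → volume (Ω \ K) ≤ ENNReal.ofReal δ →
        (∀ x ∈ K, 0 < inner ℝ x w → 0 ≤ v x) → ∀ x, 0 < inner ℝ x w → 0 ≤ v x := by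
  obtain ⟨δ, hδ, h⟩ := hk.exists_volume_poincare (2 * L + 1)
  refine ⟨δ, hδ, fun w v hv K hK hvol hvK x hx => ?_⟩
  by_cases hxΩ : x ∉ Ω
  · exact (hv.eq_zero x hxΩ).ge
  rw [not_not] at hxΩ
  set φ := halfNegPart w v with hφ
  have mφ : Measurable φ := measurable_halfNegPart w hv.measurable
  have eφ : HasEnergy k φ := hv.hasEnergy.hasEnergy_halfNegPart hk hv.measurable hv.antisymm
  obtain ⟨C, hC⟩ := hv.bounded
  have hφΩ : ∀ x, x ∉ Ω → φ x = 0 := fun x hx => halfNegPart_eq_zero (hv.eq_zero x hx).ge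
  have hφU : ∀ x, x ∉ Ω \ K → φ x = 0 := by
    intro y hy
    by_cases hyΩ : y ∈ Ω
    · have hyK : y ∈ K := by
        by_contra hyK
        exact hy ⟨hyΩ, hyK⟩
      rcases lt_or_ge 0 (inner ℝ y w) with hyw | hyw
      · exact halfNegPart_eq_zero (hvK y hyK hyw)
      · exact halfNegPart_of_nonpos hyw
    · exact hφΩ y hyΩ
  have hpoin := h (Ω \ K) (hΩ.measurableSet.diff hK) hvol φ mφ eφ hφU
  have hineq := hv.ineq φ mφ eφ (halfNegPart_nonneg w v)
    ⟨C, fun x => (halfNegPart_le_abs w v x).trans (hC x)⟩ hφΩ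
  have hkey := energyForm_halfNegPart_le hk hv.hasEnergy hv.measurable hv.antisymm (m := fun _ => 0)
    (fun _ => le_rfl) (fun _ => le_max_right _ _) (fun _ _ => rfl) (by simp)
  simp only [zero_mul, mul_zero, integral_zero, add_zero] at hkey
  have hsq : ∀ x, |v x| * φ x = φ x ^ 2 := by
    intro y
    rcases lt_or_ge 0 (inner ℝ y w) with hyw | hyw
    · rcases le_or_gt 0 (v y) with h | h
      · rw [hφ, halfNegPart_eq_zero h]
        ring
      · rw [hφ, halfNegPart_of_pos hyw, max_eq_left (by linarith), abs_of_neg h]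
        ring
    · rw [hφ, halfNegPart_of_nonpos hyw]
      ring
  simp only [hsq] at hineq
  have hint0 : ∫ x, φ x ^ 2 = 0 := by
    refine le_antisymm ?_ (integral_nonneg fun x => sq_nonneg _)
    linarith
  have hφ2 : Integrable fun x => φ x ^ 2 := by
    refine integrable_of_bounded_of_eq_zero hΩb (by fun_prop) (C := C ^ 2) (fun y => ?_)
      (fun y hy => by rw [hφΩ y hy]; ring)
    rw [abs_of_nonneg (sq_nonneg _)]
    exact pow_le_pow_left₀ (halfNegPart_nonneg w v y) ((halfNegPart_le_abs w v y).trans (hC y)) 2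
  rw [integral_eq_zero_iff_of_nonneg (fun x => sq_nonneg _) hφ2] at hint0
  refine nonneg_of_halfNegPart_ae_eq_zero hΩ hv.continuousOn ?_ hxΩ hx
  filter_upwards [hint0] with y hy
  simpa using hy

/-- If an antisymmetric supersolution is nonnegative on the half-space, then positivity at `x₁`
propagates to all points `x₀` within the range on which the kernel is strictly decreasing. The
solution is compared with a small multiple of the barrier around `x₀`; the cost of the barrier is
paid by the interaction with a ball around `x₁` where `v` is bounded below. -/
theorem IsAntisymmetricSupersolution.pos_of_pos (hk : IsLevyKernel E k) (hΩ : IsOpen Ω)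
    (hΩb : Bornology.IsBounded Ω) (hL : 0 ≤ L) (hv : IsAntisymmetricSupersolution k Ω L w v)
    (hv0 : ∀ x, 0 < inner ℝ x w → 0 ≤ v x) {x₀ x₁ : E} (h₀ : x₀ ∈ Ω) (h₁ : x₁ ∈ Ω)
    (h₀w : 0 < inner ℝ x₀ w) (h₁w : 0 < inner ℝ x₁ w) {R : ℝ} (hR : ‖x₀ - x₁‖ < R)
    (hstrict : StrictAntiOn k (Ioo 0 R)) (hpos : 0 < v x₁) : 0 < v x₀ := by
  rcases eq_or_ne x₀ x₁ with rfl | hne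
  · exact hpos
  -- between the distances to `x₁` and to its mirror image there is a gap `g`
  have hD : ‖x₀ - x₁‖ < ‖x₀ - hypRefl w x₁‖ := norm_sub_lt_norm_sub_hypRefl h₀w h₁w
  have hD0 : 0 < ‖x₀ - x₁‖ := norm_pos_iff.2 (sub_ne_zero.2 hne)
  have hQ0 : 0 < ‖x₀ - hypRefl w x₀‖ := by
    have := norm_sub_lt_norm_sub_hypRefl h₀w h₀w
    rwa [sub_self, norm_zero] at this
  obtain ⟨g, hg0, hgD, hgR⟩ : ∃ g, 0 < g ∧ ‖x₀ - x₁‖ + g ≤ ‖x₀ - hypRefl w x₁‖ ∧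
      ‖x₀ - x₁‖ + g ≤ R :=
    ⟨min (‖x₀ - hypRefl w x₁‖ - ‖x₀ - x₁‖) (R - ‖x₀ - x₁‖), lt_min (by linarith) (by linarith),
      by linarith [min_le_left (‖x₀ - hypRefl w x₁‖ - ‖x₀ - x₁‖) (R - ‖x₀ - x₁‖)],
      by linarith [min_le_right (‖x₀ - hypRefl w x₁‖ - ‖x₀ - x₁‖) (R - ‖x₀ - x₁‖)]⟩
  set d := ‖x₀ - x₁‖ with hd
  have hγ : k (d + g / 2) < k (d + g / 4) :=
    hstrict ⟨by linarith, by linarith⟩ ⟨by linarith, by linarith⟩ (by linarith)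
  -- the radius of the balls around `x₀` and `x₁`
  have hopenH : IsOpen {x : E | 0 < inner ℝ x w} := isOpen_lt continuous_const (by fun_prop)
  have hn0 : Ω ∩ {x : E | 0 < inner ℝ x w} ∈ nhds x₀ := (hΩ.inter hopenH).mem_nhds ⟨h₀, h₀w⟩
  have hn1 : (Ω ∩ v ⁻¹' Ioi (v x₁ / 2)) ∩ {x : E | 0 < inner ℝ x w} ∈ nhds x₁ :=
    ((hv.continuousOn.isOpen_inter_preimage hΩ isOpen_Ioi).inter hopenH).mem_nhds
      ⟨⟨h₁, by simp only [mem_preimage, mem_Ioi]; linarith⟩, h₁w⟩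
  obtain ⟨ρ₀, hρ₀, hb0⟩ := Metric.mem_nhds_iff.1 hn0
  obtain ⟨ρ₁, hρ₁, hb1⟩ := Metric.mem_nhds_iff.1 hn1
  obtain ⟨r, hr, hr0, hr1, hrg, hrd, hrQ⟩ : ∃ r, 0 < r ∧ r ≤ ρ₀ ∧ r ≤ ρ₁ ∧ 8 * r ≤ g ∧
      4 * r ≤ d ∧ 4 * r ≤ ‖x₀ - hypRefl w x₀‖ := by
    have hm : 0 < min (min ρ₀ ρ₁) (min g (min d ‖x₀ - hypRefl w x₀‖)) :=
      lt_min (lt_min hρ₀ hρ₁) (lt_min hg0 (lt_min hD0 hQ0))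
    have l1 := min_le_left (min ρ₀ ρ₁) (min g (min d ‖x₀ - hypRefl w x₀‖))
    have l2 := min_le_right (min ρ₀ ρ₁) (min g (min d ‖x₀ - hypRefl w x₀‖))
    have l3 := min_le_left ρ₀ ρ₁
    have l4 := min_le_right ρ₀ ρ₁
    have l5 := min_le_left g (min d ‖x₀ - hypRefl w x₀‖)
    have l6 := min_le_right g (min d ‖x₀ - hypRefl w x₀‖)
    have l7 := min_le_left d ‖x₀ - hypRefl w x₀‖
    have l8 := min_le_right d ‖x₀ - hypRefl w x₀‖
    refine ⟨min (min ρ₀ ρ₁) (min g (min d ‖x₀ - hypRefl w x₀‖)) / 8, ?_, ?_, ?_, ?_, ?_, ?_⟩ <;>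
      linarith
  have hball0 : ∀ x, ‖x - x₀‖ < r → x ∈ Ω ∧ 0 < inner ℝ x w := fun x hx =>
    hb0 (by rw [Metric.mem_ball, dist_eq_norm]; linarith)
  have hball1 : ∀ x, ‖x - x₁‖ < r → v x₁ / 2 < v x ∧ 0 < inner ℝ x w := fun x hx => by
    have := hb1 (show x ∈ Metric.ball x₁ ρ₁ by rw [Metric.mem_ball, dist_eq_norm]; linarith)
    exact ⟨this.1.2, this.2⟩
  have hdist : ∀ x y, ‖x - x₀‖ < r → ‖y - x₁‖ < r → d / 2 ≤ ‖x - y‖ ∧ ‖x - y‖ ≤ d + g / 4 ∧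
      d + g / 2 ≤ ‖x - hypRefl w y‖ := by
    intro x y hx hy
    have t1 : ‖x₀ - x₁‖ ≤ ‖x - x₀‖ + ‖x - y‖ + ‖y - x₁‖ := by
      have e : x₀ - x₁ = -(x - x₀) + (x - y) + (y - x₁) := by abel
      rw [e, ← norm_neg (x - x₀)]
      exact norm_add₃_le
    have t2 : ‖x - y‖ ≤ ‖x - x₀‖ + ‖x₀ - x₁‖ + ‖y - x₁‖ := by
      have e : x - y = (x - x₀) + (x₀ - x₁) + -(y - x₁) := by abel
      rw [e, ← norm_neg (y - x₁)]
      exact norm_add₃_le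
    have t3 : ‖x₀ - hypRefl w x₁‖ ≤ ‖x - x₀‖ + ‖x - hypRefl w y‖ + ‖y - x₁‖ := by
      have e : x₀ - hypRefl w x₁ = -(x - x₀) + (x - hypRefl w y)
        + (hypRefl w y - hypRefl w x₁) := by abel
      rw [e, ← norm_neg (x - x₀), ← norm_hypRefl_sub_hypRefl w y]
      exact norm_add₃_le
    refine ⟨?_, ?_, ?_⟩ <;> linarith
  -- the gain constant, the cost constant, and the height of the barrier
  set a := v x₁ / 2 with ha
  have ha0 : 0 < a := by positivity
  set B := Metric.ball x₁ r with hB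
  have hBvol : 0 < volume.real B :=
    ENNReal.toReal_pos (Metric.measure_ball_pos _ _ hr).ne' measure_ball_lt_top.ne
  set G := (k (d + g / 4) - k (d + g / 2)) * (a * volume.real B) with hG
  have hG0 : 0 < G := mul_pos (by linarith) (mul_pos ha0 hBvol)
  set A := 4 * (1 + r ^ 2) * ∫ z : E, min 1 (‖z‖ ^ 2) * k ‖z‖ with hA
  have hA0 : 0 ≤ A := mul_nonneg (by positivity)
    (integral_nonneg fun z => mul_nonneg (by positivity) (hk.nonneg _))
  set τ := G / (2 * L * r ^ 2 + A + 1) with hτ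
  have hτ0 : 0 < τ := by positivity
  have hτG : τ * (2 * L * r ^ 2 + A) < 2 * G := by
    have : τ * (2 * L * r ^ 2 + A + 1) = G := by rw [hτ]; field_simp
    linarith
  set θ := barrier w x₀ r with hθ
  have mθ : Measurable θ := (continuous_barrier w).measurable
  have eθ : HasEnergy k θ := hasEnergy_barrier hk hr.le w
  set ψ : E → ℝ := fun x => v x - τ * θ x with hψ
  have mψ : Measurable ψ := hv.measurable.sub (mθ.const_mul τ)
  have eψ : HasEnergy k ψ :=
    hv.hasEnergy.sub hk (eθ.const_mul τ) hv.measurable (mθ.const_mul τ)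
  have aψ : ∀ x, ψ (hypRefl w x) = - ψ x := by
    intro x
    simp only [hψ, hv.antisymm, hθ, barrier_hypRefl]
    ring
  have hψle : ∀ x, v x - τ * paraboloid x₀ r x ≤ ψ x := by
    intro x
    have := mul_nonneg hτ0.le (paraboloid_nonneg (x₀ := x₀) hr.le (hypRefl w x))
    simp only [hψ, hθ, barrier]
    linarith
  set φ := halfNegPart w ψ with hφ
  have mφ : Measurable φ := measurable_halfNegPart w mψ
  have eφ : HasEnergy k φ := eψ.hasEnergy_halfNegPart hk mψ aψ
  have φ0 : ∀ x, 0 ≤ φ x := halfNegPart_nonneg w ψ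
  have φball : ∀ x, φ x ≠ 0 → ‖x - x₀‖ < r := by
    intro x hx
    by_contra hcon
    rw [not_lt] at hcon
    rcases lt_or_ge 0 (inner ℝ x w) with hxw | hxw
    · refine hx (halfNegPart_eq_zero ?_)
      have := hψle x
      rw [paraboloid_eq_zero hcon] at this
      linarith [hv0 x hxw]
    · exact hx (halfNegPart_of_nonpos hxw)
  have φv : ∀ x, φ x ≠ 0 → 0 ≤ v x ∧ v x ≤ τ * r ^ 2 ∧ φ x ≤ τ * r ^ 2 := by
    intro x hx
    have hxw := (hball0 x (φball x hx)).2
    have h1 := hv0 x hxw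
    have h2 : ψ x < 0 := by
      by_contra hcon
      exact hx (halfNegPart_eq_zero (not_lt.1 hcon))
    have h3 := hψle x
    have h4 := mul_le_mul_of_nonneg_left (paraboloid_le (x₀ := x₀) (r := r) x) hτ0.le
    refine ⟨h1, by linarith, ?_⟩
    rw [hφ, halfNegPart_of_pos hxw]
    exact max_le (by linarith) (by positivity)
  have φΩ : ∀ x, x ∉ Ω → φ x = 0 := by
    intro x hx
    by_contra hcon
    exact hx (hball0 x (φball x hcon)).1
  have φle : ∀ x, φ x ≤ τ * r ^ 2 := by
    intro x
    by_cases hx : φ x = 0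
    · rw [hx]; positivity
    · exact (φv x hx).2.2
  have iφ : Integrable φ := integrable_of_bounded_of_eq_zero hΩb mφ
    (fun x => by rw [abs_of_nonneg (φ0 x)]; exact φle x) φΩ
  have hineq := hv.ineq φ mφ eφ φ0 ⟨_, φle⟩ φΩ
  have hvφ : ∫ x, |v x| * φ x ≤ τ * r ^ 2 * ∫ x, φ x := by
    rw [← integral_const_mul]
    refine integral_mono_of_nonneg (ae_of_all _ fun x => mul_nonneg (abs_nonneg _) (φ0 x))
      (iφ.const_mul _) (ae_of_all _ fun x => ?_)
    by_cases hx : φ x = 0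
    · simp [hx]
    · have := φv x hx
      simp only
      rw [abs_of_nonneg this.1]
      exact mul_le_mul_of_nonneg_right this.2.1 (φ0 x)
  have hθφ : energyForm k θ φ ≤ A * ∫ x, φ x :=
    energyForm_le_of_second_difference_le hk (by positivity) mθ eθ (abs_barrier_le hr.le w) mφ eφ
      φ0 iφ fun x hx z => two_mul_barrier_sub_le hr.le hrQ (φball x hx) z
  have hEψ : energyForm k ψ φ = energyForm k v φ - τ * energyForm k θ φ := by
    rw [hψ, energyForm_sub_left hk hv.hasEnergy (eθ.const_mul τ) eφ hv.measurable
      (mθ.const_mul τ) mφ, energyForm_const_mul_left]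
  -- the gain from the ball around `x₁`
  set m : E → ℝ := B.indicator fun _ => a with hm
  have mm : Measurable m := measurable_const.indicator measurableSet_ball
  have im : Integrable m := by
    rw [hm, integrable_indicator_iff measurableSet_ball]
    exact integrableOn_const measure_ball_lt_top.ne
  have hm0 : ∀ x, 0 ≤ m x := fun x => indicator_nonneg (fun _ _ => ha0.le) x
  have hmne : ∀ x, m x ≠ 0 → ‖x - x₁‖ < r := by
    intro x hx
    have := mem_of_indicator_ne_zero hx
    rwa [hB, Metric.mem_ball, dist_eq_norm] at this
  have hmψ : ∀ x, m x ≤ max (ψ x) 0 := by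
    intro x
    by_cases hx : m x = 0
    · rw [hx]
      exact le_max_right _ _
    · have hxB := mem_of_indicator_ne_zero hx
      have hxr := hmne x hx
      have hfar : r ≤ ‖x - x₀‖ := by
        have := norm_sub_le_norm_sub_add_norm_sub x₀ x x₁
        rw [norm_sub_rev x₀ x] at this
        linarith
      have := hψle x
      rw [paraboloid_eq_zero hfar] at this
      rw [hm, indicator_of_mem hxB]
      refine le_max_of_le_left ?_
      linarith [(hball1 x hxr).1]
  have hmw : ∀ x, inner ℝ x w ≤ 0 → m x = 0 := by
    intro x hx
    by_contra hcon
    exact absurd (hball1 x (hmne x hcon)).2 hx.not_gt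
  have hgain : ∀ x y, φ x * (m y * (k (d + g / 4) - k (d + g / 2))) ≤
      φ x * (m y * (k ‖x - y‖ - k ‖x - hypRefl w y‖)) ∧
      φ x * (m y * (k ‖x - y‖ - k ‖x - hypRefl w y‖)) ≤ φ x * m y * k (d / 2) := by
    intro x y
    by_cases hx : φ x = 0
    · simp [hx]
    by_cases hy : m y = 0
    · simp [hy]
    obtain ⟨h1, h2, h3⟩ := hdist x y (φball x hx) (hmne y hy)
    have p1 : 0 < ‖x - y‖ := by linarith
    have k1 : k (d + g / 4) ≤ k ‖x - y‖ := hk.antitone p1 (p1.trans_le h2) h2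
    have k2 : k ‖x - hypRefl w y‖ ≤ k (d + g / 2) := by
      have : (0 : ℝ) < d + g / 2 := by linarith
      exact hk.antitone this (this.trans_le h3) h3
    have k3 : k ‖x - y‖ ≤ k (d / 2) := by
      have : (0 : ℝ) < d / 2 := by linarith
      exact hk.antitone this p1 h1
    have k4 := hk.nonneg ‖x - hypRefl w y‖
    rw [mul_assoc (φ x)]
    exact ⟨mul_le_mul_of_nonneg_left (mul_le_mul_of_nonneg_left (by linarith) (hm0 y)) (φ0 x),
      mul_le_mul_of_nonneg_left (mul_le_mul_of_nonneg_left (by linarith) (hm0 y)) (φ0 x)⟩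
  have iprod : Integrable fun p : E × E => φ p.1 * m p.2 := iφ.mul_prod im
  have hint : Integrable fun p : E × E =>
      φ p.1 * (m p.2 * (k ‖p.1 - p.2‖ - k ‖p.1 - hypRefl w p.2‖)) := by
    have mk1 := hk.measurable_norm_sub
    have mk2 : Measurable fun p : E × E => k ‖p.1 - hypRefl w p.2‖ :=
      hk.measurable.comp
        ((continuous_fst.sub ((hypRefl w).continuous.comp continuous_snd)).norm.measurable)
    refine (iprod.mul_const (k (d / 2))).mono' ?_ (ae_of_all _ fun p => ?_)
    · exact ((mφ.comp measurable_fst).mul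
        ((mm.comp measurable_snd).mul (mk1.sub mk2))).aestronglyMeasurable
    · obtain ⟨h1, h2⟩ := hgain p.1 p.2
      rw [Real.norm_of_nonneg]
      · exact h2
      · refine le_trans ?_ h1
        exact mul_nonneg (φ0 _) (mul_nonneg (hm0 _) (by linarith))
  have hGint : G * ∫ x, φ x ≤ ∫ p : E × E,
      φ p.1 * (m p.2 * (k ‖p.1 - p.2‖ - k ‖p.1 - hypRefl w p.2‖)) := by
    have e : ∫ p : E × E, φ p.1 * (m p.2 * (k (d + g / 4) - k (d + g / 2))) = G * ∫ x, φ x := by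
      have e1 : ∫ y, m y * (k (d + g / 4) - k (d + g / 2)) = G := by
        rw [integral_mul_const, hm, integral_indicator measurableSet_ball, setIntegral_const,
          smul_eq_mul, hG]
        ring
      rw [← e1, mul_comm, ← integral_prod_mul]
      rfl
    rw [← e]
    refine integral_mono ?_ hint fun p => (hgain p.1 p.2).1
    exact iφ.mul_prod (im.mul_const _)
  have hkey := energyForm_halfNegPart_le hk eψ mψ aψ hm0 hmψ hmw hint
  have hself := energyForm_self_nonneg hk φ
  rw [← hφ, hEψ] at hkey
  have hφint : ∫ x, φ x = 0 := by
    refine le_antisymm ?_ (integral_nonneg φ0)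
    have n1 : 2 * L * ∫ x, |v x| * φ x ≤ 2 * L * (τ * r ^ 2 * ∫ x, φ x) :=
      mul_le_mul_of_nonneg_left hvφ (by positivity)
    have n2 : τ * energyForm k θ φ ≤ τ * (A * ∫ x, φ x) :=
      mul_le_mul_of_nonneg_left hθφ hτ0.le
    by_contra hcon
    have := mul_lt_mul_of_pos_right hτG (not_le.1 hcon)
    linarith
  rw [integral_eq_zero_iff_of_nonneg φ0 iφ] at hφint
  have hψc : ContinuousOn ψ Ω :=
    hv.continuousOn.sub ((continuous_barrier w).continuousOn.const_smul τ)
  have hfin := nonneg_of_halfNegPart_ae_eq_zero hΩ hψc hφint h₀ h₀w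
  have hθ0 : θ x₀ = r ^ 2 := by
    rw [hθ, barrier, paraboloid_self hr.le, paraboloid_eq_zero, sub_zero]
    rw [norm_sub_rev]
    linarith
  simp only [hψ, hθ0] at hfin
  have : 0 < τ * r ^ 2 := by positivity
  linarith

end MaximumPrinciple

/-! ### The strong maximum principle -/

section StrongMaximumPrinciple

variable {N : ℕ} {Ω : Set (EuclideanSpace ℝ (Fin N))} {k : ℝ → ℝ}

theorem IsRadialSet.hypRefl_mem (hΩ : IsRadialSet Ω) (w : EuclideanSpace ℝ (Fin N))
    {x : EuclideanSpace ℝ (Fin N)} (hx : x ∈ Ω) : hypRefl w x ∈ Ω :=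
  hΩ x _ (LinearIsometryEquiv.norm_map _ _).symm hx

theorem IsRadialSet.hypRefl_notMem (hΩ : IsRadialSet Ω) (w : EuclideanSpace ℝ (Fin N))
    {x : EuclideanSpace ℝ (Fin N)} (hx : x ∉ Ω) : hypRefl w x ∉ Ω := fun h =>
  hx (by simpa using hΩ.hypRefl_mem w h)

/-- The part of a connected radial set in an open half-space is connected: it is the image of the
product of an interval of radii with the half-space. -/
theorem IsRadialSet.isPreconnected_inter_halfSpace (hΩ : IsRadialSet Ω) (hc : IsConnected Ω)
    (w : EuclideanSpace ℝ (Fin N)) :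
    IsPreconnected (Ω ∩ {x | 0 < inner ℝ x w}) := by
  set H := {x : EuclideanSpace ℝ (Fin N) | 0 < inner ℝ x w} with hH
  have hH0 : ∀ x ∈ H, 0 < ‖x‖ := by
    intro x hx
    refine norm_pos_iff.2 ?_
    rintro rfl
    simp [hH] at hx
  have hI : IsPreconnected ((norm '' Ω) ∩ Ioi (0 : ℝ)) := by
    have h1 : IsPreconnected (norm '' Ω) :=
      hc.isPreconnected.image _ continuous_norm.continuousOn
    exact (h1.ordConnected.inter ordConnected_Ioi).isPreconnected
  have hHc : IsPreconnected H := by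
    refine Convex.isPreconnected ?_
    have : H = {x | 0 < innerSL ℝ w x} := by
      ext x
      simp [hH, real_inner_comm]
    rw [this]
    exact convex_halfSpace_gt (innerSL ℝ w).toLinearMap.isLinear 0
  have himg : Ω ∩ H = (fun p : ℝ × EuclideanSpace ℝ (Fin N) => (p.1 / ‖p.2‖) • p.2) ''
      (((norm '' Ω) ∩ Ioi (0 : ℝ)) ×ˢ H) := by
    ext x
    constructor
    · rintro ⟨hx, hxH⟩
      refine ⟨(‖x‖, x), ⟨⟨⟨x, hx, rfl⟩, hH0 x hxH⟩, hxH⟩, ?_⟩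
      simp only
      rw [div_self (hH0 x hxH).ne', one_smul]
    · rintro ⟨⟨r, y⟩, ⟨⟨⟨z, hz, rfl⟩, hr⟩, hy⟩, rfl⟩
      have hy0 := hH0 y hy
      simp only [mem_Ioi] at hr
      refine ⟨hΩ z _ ?_ hz, ?_⟩
      · simp only [norm_smul, norm_div, norm_norm]
        field_simp
      · have hy' : 0 < inner ℝ y w := hy
        simp only [hH, mem_ofPred_eq, real_inner_smul_left]
        positivity
  rw [himg]
  refine (hI.prod hHc).image _ ?_
  rintro ⟨r, y⟩ ⟨-, hy⟩
  refine ContinuousAt.continuousWithinAt ?_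
  refine ContinuousAt.smul (ContinuousAt.div continuousAt_fst ?_ (hH0 y hy).ne') continuousAt_snd
  fun_prop

/-- Strong maximum principle. If `Ω` is connected, positivity spreads in small steps; otherwise the
strict monotonicity of the kernel carries it over all distances at once. -/
theorem IsAntisymmetricSupersolution.pos (hk : IsLevyKernel (EuclideanSpace ℝ (Fin N)) k)
    (hΩ : IsOpen Ω) (hΩb : Bornology.IsBounded Ω) (hΩr : IsRadialSet Ω) {L : ℝ} (hL : 0 ≤ L)
    (hnear : ∃ R : ℝ, 0 < R ∧ StrictAntiOn k (Ioo 0 R))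
    (hstrict : ¬ IsConnected Ω → StrictAntiOn k (Ioi 0))
    {w : EuclideanSpace ℝ (Fin N)} {v : EuclideanSpace ℝ (Fin N) → ℝ}
    (hv : IsAntisymmetricSupersolution k Ω L w v) (hv0 : ∀ x, 0 < inner ℝ x w → 0 ≤ v x)
    {x₁ : EuclideanSpace ℝ (Fin N)} (h₁ : x₁ ∈ Ω) (h₁w : 0 < inner ℝ x₁ w) (hpos : 0 < v x₁)
    {x : EuclideanSpace ℝ (Fin N)} (hx : x ∈ Ω) (hxw : 0 < inner ℝ x w) : 0 < v x := by
  by_cases hc : IsConnected Ω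
  · obtain ⟨R, hR, hs⟩ := hnear
    have hpre := hΩr.isPreconnected_inter_halfSpace hc w
    have hopen : IsOpen ((Ω ∩ v ⁻¹' Ioi 0) ∩ {x | 0 < inner ℝ x w}) :=
      (hv.continuousOn.isOpen_inter_preimage hΩ isOpen_Ioi).inter
        (isOpen_lt continuous_const (by fun_prop))
    have hsub := hpre.subset_of_closure_inter_subset hopen
      ⟨x₁, ⟨h₁, h₁w⟩, ⟨⟨h₁, hpos⟩, h₁w⟩⟩ ?_
    · exact (hsub ⟨hx, hxw⟩).1.2
    rintro y ⟨hyc, hyΩ, hyw⟩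
    obtain ⟨z, ⟨⟨hzΩ, hz⟩, hzw⟩, hyz⟩ := Metric.mem_closure_iff.1 hyc R hR
    rw [dist_eq_norm] at hyz
    exact ⟨⟨hyΩ, hv.pos_of_pos hk hΩ hΩb hL hv0 hyΩ hzΩ hyw hzw hyz hs hz⟩, hyw⟩
  · exact hv.pos_of_pos hk hΩ hΩb hL hv0 hx h₁ hxw h₁w (lt_add_one _)
      ((hstrict hc).mono fun s hs => hs.1) hpos

end StrongMaximumPrinciple

/-! ### Reflection differences of solutions -/

section Solutions

variable {N : ℕ} {Ω : Set (EuclideanSpace ℝ (Fin N))} {k : ℝ → ℝ} {f : ℝ → ℝ → ℝ}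
  {u : EuclideanSpace ℝ (Fin N) → ℝ}

/-- The arbitrary value `k 0` plays no role in energies, as differences vanish on the diagonal. -/
theorem mul_indicator_Ioi_norm_sub (k : ℝ → ℝ) {g : ℝ}
    {x y : EuclideanSpace ℝ (Fin N)} (hg : x = y → g = 0) :
    g * (Ioi 0).indicator k ‖x - y‖ = g * k ‖x - y‖ := by
  rcases eq_or_ne x y with h | h
  · rw [hg h, zero_mul, zero_mul]
  · rw [indicator_of_mem]
    exact norm_pos_iff.2 (sub_ne_zero.2 h)

theorem bilinForm_eq_energyForm (k : ℝ → ℝ) (v φ : EuclideanSpace ℝ (Fin N) → ℝ) :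
    bilinForm k v φ = 1 / 2 * energyForm ((Ioi 0).indicator k) v φ := by
  rw [bilinForm, energyForm]
  congr 2 with p
  rw [mul_indicator_Ioi_norm_sub]
  intro h
  simp [h]

theorem lintegral_energy_lt_top_iff
    (hk : IsLevyKernel (EuclideanSpace ℝ (Fin N)) ((Ioi 0).indicator k))
    {v : EuclideanSpace ℝ (Fin N) → ℝ} (mv : Measurable v) :
    ∫⁻ p : EuclideanSpace ℝ (Fin N) × EuclideanSpace ℝ (Fin N),
      ENNReal.ofReal ((v p.1 - v p.2) ^ 2 * k ‖p.1 - p.2‖) < ⊤ ↔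
      HasEnergy ((Ioi 0).indicator k) v := by
  have mk := hk.measurable_norm_sub
  have h : ∀ p : EuclideanSpace ℝ (Fin N) × EuclideanSpace ℝ (Fin N),
      (v p.1 - v p.2) ^ 2 * k ‖p.1 - p.2‖ =
        (v p.1 - v p.2) ^ 2 * (Ioi 0).indicator k ‖p.1 - p.2‖ := fun p =>
    (mul_indicator_Ioi_norm_sub k fun h => by simp [h]).symm
  simp only [h]
  have hm : AEStronglyMeasurable (fun p : EuclideanSpace ℝ (Fin N) × EuclideanSpace ℝ (Fin N) =>
      (v p.1 - v p.2) ^ 2 * (Ioi 0).indicator k ‖p.1 - p.2‖) volume :=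
    (Measurable.mul (by fun_prop) mk).aestronglyMeasurable
  rw [HasEnergy, Integrable, and_iff_right hm,
    hasFiniteIntegral_iff_ofReal (ae_of_all _ fun p => mul_nonneg (sq_nonneg _) (hk.nonneg _))]

theorem measurable_of_continuousOn_of_eq_zero (hΩ : IsOpen Ω) (hu : ContinuousOn u Ω)
    (h0 : ∀ x, x ∉ Ω → u x = 0) : Measurable u := by
  classical
  have h := hu.measurable_piecewise (g := fun _ => 0) continuousOn_const hΩ.measurableSet
  convert h using 1
  ext x
  by_cases hx : x ∈ Ω
  · rw [piecewise_eq_of_mem _ _ _ hx]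
  · rw [piecewise_eq_of_notMem _ _ _ hx, h0 x hx]

theorem integral_comp_isometry (g : EuclideanSpace ℝ (Fin N) → ℝ)
    (Q : EuclideanSpace ℝ (Fin N) ≃ₗᵢ[ℝ] EuclideanSpace ℝ (Fin N)) :
    ∫ x, g (Q x) = ∫ x, g x :=
  Q.measurePreserving.integral_comp Q.toHomeomorph.measurableEmbedding g

/-- Testing the equation with `φ` and with its mirror image and using the Lipschitz bound, the
difference of a solution and its reflection is an antisymmetric supersolution, with a constant
independent of the hyperplane. -/
theorem IsWeakSolution.isAntisymmetricSupersolution (hN : 2 ≤ N) (hΩ : IsOpen Ω)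
    (hΩb : Bornology.IsBounded Ω) (hΩr : IsRadialSet Ω) (hk : KernelCondition N k)
    (hf : UniformlyLocallyLipschitz f) (hu : IsWeakSolution k f Ω u)
    (hub : ∃ C : ℝ, ∀ x, |u x| ≤ C) (huc : ContinuousOn u Ω) :
    ∃ L : ℝ, 0 ≤ L ∧ ∀ w, IsAntisymmetricSupersolution ((Ioi 0).indicator k) Ω L w
      fun x => u x - u (hypRefl w x) := by
  obtain ⟨C, hC⟩ := hub
  have hC0 : 0 ≤ C := (abs_nonneg _).trans (hC 0)
  obtain ⟨L, hL, hLip⟩ := hf (C + 1) (by linarith)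
  have hk' := hk.isLevyKernel hN
  have mu : Measurable u := measurable_of_continuousOn_of_eq_zero hΩ huc hu.mem.eq_zero
  have eu : HasEnergy ((Ioi 0).indicator k) u :=
    (lintegral_energy_lt_top_iff hk' mu).1 hu.mem.energy_lt_top
  refine ⟨L, hL.le, fun w => ?_⟩
  have muQ : Measurable fun x => u (hypRefl w x) := mu.comp (hypRefl w).continuous.measurable
  have euQ := eu.comp_isometry (hypRefl w)
  refine ⟨mu.sub muQ, ⟨C + C, fun x => ?_⟩, eu.sub hk' euQ mu muQ, fun x => by simp,
    fun x hx => ?_, ?_, ?_⟩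
  · exact (abs_sub _ _).trans (add_le_add (hC _) (hC _))
  · rw [hu.mem.eq_zero x hx, hu.mem.eq_zero _ (hΩr.hypRefl_notMem w hx), sub_zero]
  · exact huc.sub (huc.comp (hypRefl w).continuous.continuousOn fun x hx => hΩr.hypRefl_mem w hx)
  intro φ mφ eφ hφ0 hφb hφΩ
  obtain ⟨D, hD⟩ := hφb
  have mem : ∀ φ : EuclideanSpace ℝ (Fin N) → ℝ, Measurable φ →
      HasEnergy ((Ioi 0).indicator k) φ → (∀ x, |φ x| ≤ D) → (∀ x, x ∉ Ω → φ x = 0) →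
      MemEnergySpace k Ω φ ∧ HasCompactSupport φ := by
    intro φ mφ eφ hD h0
    refine ⟨⟨?_, (lintegral_energy_lt_top_iff hk' mφ).2 eφ, h0⟩, ?_⟩
    · rw [memLp_two_iff_integrable_sq mφ.aestronglyMeasurable]
      refine integrable_of_bounded_of_eq_zero hΩb (mφ.pow_const 2) (C := D ^ 2) (fun x => ?_)
        fun x hx => by rw [h0 x hx]; ring
      rw [abs_pow]
      exact pow_le_pow_left₀ (abs_nonneg _) (hD x) 2
    · exact HasCompactSupport.intro hΩb.isCompact_closure fun x hx =>
        h0 x fun h => hx (subset_closure h)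
  have mφQ : Measurable fun x => φ (hypRefl w x) := mφ.comp (hypRefl w).continuous.measurable
  have eφQ := eφ.comp_isometry (hypRefl w)
  have hDabs : ∀ x, |φ x| ≤ D := fun x => by rw [abs_of_nonneg (hφ0 x)]; exact hD x
  have hφQΩ : ∀ x, x ∉ Ω → φ (hypRefl w x) = 0 := fun x hx => hφΩ _ (hΩr.hypRefl_notMem w hx)
  obtain ⟨a1, a2⟩ := mem φ mφ eφ hDabs hφΩ
  obtain ⟨b1, b2⟩ := mem _ mφQ eφQ (fun x => hDabs _) hφQΩ
  obtain ⟨i1, e1⟩ := hu.weak_eq φ a1 a2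
  obtain ⟨i2, e2⟩ := hu.weak_eq _ b1 b2
  rw [setIntegral_eq_integral_of_forall_compl_eq_zero
    (fun x hx => by rw [hφΩ x hx, mul_zero]), bilinForm_eq_energyForm] at e1
  rw [setIntegral_eq_integral_of_forall_compl_eq_zero
    (fun x hx => by rw [hφQΩ x hx, mul_zero]), bilinForm_eq_energyForm,
    ← integral_comp_isometry _ (hypRefl w), ← energyForm_comp_isometry _ _ (hypRefl w)] at e2
  have i2' := ((hypRefl w).measurePreserving).integrable_comp_of_integrable i2
  simp only [hypRefl_hypRefl, LinearIsometryEquiv.norm_map, Function.comp_def] at e2 i2'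
  have hform : energyForm ((Ioi 0).indicator k) (fun x => u x - u (hypRefl w x)) φ =
      2 * ∫ x, (f ‖x‖ (u x) * φ x - f ‖x‖ (u (hypRefl w x)) * φ x) := by
    rw [energyForm_sub_left hk' eu euQ eφ mu muQ mφ, integral_sub i1 i2']
    linarith
  have ivφ : Integrable fun x => |u x - u (hypRefl w x)| * φ x := by
    refine integrable_of_bounded_of_eq_zero hΩb ((mu.sub muQ).norm.mul mφ) (C := (C + C) * D)
      (fun x => ?_) fun x hx => by rw [hφΩ x hx, mul_zero]
    rw [abs_mul, abs_abs]
    exact mul_le_mul ((abs_sub _ _).trans (add_le_add (hC _) (hC _))) (hDabs x) (abs_nonneg _)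
      (by linarith)
  have hle : -(L * ∫ x, |u x - u (hypRefl w x)| * φ x) ≤
      ∫ x, (f ‖x‖ (u x) * φ x - f ‖x‖ (u (hypRefl w x)) * φ x) := by
    rw [← integral_const_mul, ← integral_neg]
    refine integral_mono (ivφ.const_mul L).neg (i1.sub i2') fun x => ?_
    have hmem : ∀ y, u y ∈ Icc (-(C + 1)) (C + 1) := fun y => by
      have := abs_le.1 (hC y)
      exact ⟨by linarith [this.1], by linarith [this.2]⟩
    have h1 := hLip ‖x‖ (norm_nonneg _) (u x) (hmem _) (u (hypRefl w x)) (hmem _)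
    have h2 := mul_le_mul_of_nonneg_right (abs_le.1 h1).1 (hφ0 x)
    simp only
    linarith
  rw [hform]
  linarith

end Solutions

/-! ### The cone of directions of reflection positivity -/

section Directions

variable {E : Type*} [NormedAddCommGroup E] [InnerProductSpace ℝ E]

/-- The directions `w ≠ 0` such that `u` is strictly larger than its reflection `u ∘ hypRefl w` on
the part of `Ω` in the half-space `{x | 0 < ⟪x, w⟫}`. -/
def positiveDirections (Ω : Set E) (u : E → ℝ) : Set E :=
  {w | w ≠ 0 ∧ ∀ x ∈ Ω, 0 < inner ℝ x w → u (hypRefl w x) < u x}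

/-- The directions `w` such that `u` is invariant under the reflection `hypRefl w`, including
`w = 0`. -/
def symmetricDirections (u : E → ℝ) : Set E := {w | ∀ x, u (hypRefl w x) = u x}

variable {Ω : Set E} {u : E → ℝ} {a b z w : E}

theorem inner_hypRefl_left (w x y : E) : inner ℝ (hypRefl w x) y = inner ℝ x (hypRefl w y) := by
  rw [← LinearIsometryEquiv.inner_map_map (hypRefl w), hypRefl_hypRefl]

theorem smul_mem_positiveDirections (ha : a ∈ positiveDirections Ω u) {c : ℝ} (hc : 0 < c) :
    c • a ∈ positiveDirections Ω u := by
  refine ⟨smul_ne_zero hc.ne' ha.1, fun x hx h => ?_⟩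
  rw [hypRefl_smul hc.ne']
  rw [real_inner_smul_right] at h
  exact ha.2 x hx (pos_of_mul_pos_right h hc.le)

theorem smul_mem_symmetricDirections (hz : z ∈ symmetricDirections u) (c : ℝ) :
    c • z ∈ symmetricDirections u := by
  intro x
  rcases eq_or_ne c 0 with rfl | hc
  · simp
  · rw [hypRefl_smul hc]
    exact hz x

variable (hΩ : ∀ x y : E, ‖x‖ = ‖y‖ → x ∈ Ω → y ∈ Ω) (hne : ∃ x ∈ Ω, x ≠ 0)
include hΩ hne

/-- Every ray meets the radial set `Ω`. -/
theorem exists_pos_smul_mem (hw : w ≠ 0) : ∃ c : ℝ, 0 < c ∧ c • w ∈ Ω := by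
  obtain ⟨x, hx, hx0⟩ := hne
  have h1 := norm_pos_iff.2 hw
  have h2 := norm_pos_iff.2 hx0
  refine ⟨‖x‖ / ‖w‖, by positivity, hΩ x _ ?_ hx⟩
  rw [norm_smul, norm_div, norm_norm, norm_norm]
  field_simp

theorem notMem_symmetricDirections (ha : a ∈ positiveDirections Ω u) :
    a ∉ symmetricDirections u := by
  intro h
  obtain ⟨c, hc, hca⟩ := exists_pos_smul_mem hΩ hne ha.1
  have := ha.2 _ hca (by
    rw [real_inner_smul_left]
    exact mul_pos hc (real_inner_self_pos.2 ha.1))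
  rw [h] at this
  exact this.false

theorem neg_notMem_positiveDirections (ha : a ∈ positiveDirections Ω u) :
    -a ∉ positiveDirections Ω u := by
  intro h
  obtain ⟨c, hc, hca⟩ := exists_pos_smul_mem hΩ hne ha.1
  have hpos : 0 < inner ℝ (c • a) a := by
    rw [real_inner_smul_left]
    exact mul_pos hc (real_inner_self_pos.2 ha.1)
  have h1 := ha.2 _ hca hpos
  have h2 := h.2 (hypRefl a (c • a)) (hΩ _ _ (LinearIsometryEquiv.norm_map _ _).symm hca) (by
    rw [inner_neg_right, inner_hypRefl, neg_neg]
    exact hpos)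
  rw [← neg_one_smul ℝ a, hypRefl_smul (by norm_num), hypRefl_hypRefl] at h2
  exact h1.not_gt h2

/-- A direction of strict reflection positivity does not lie in a plane spanned by two different
directions of symmetry. Indeed, the product `R` of the two symmetries is a rotation of that plane
which preserves `u`; as reflections conjugate rotations into their inverses, `R` also preserves
`u - u ∘ hypRefl a`, hence the half-space in which this difference is positive. This forces `R` to
fix `a`. -/
theorem add_smul_notMem_symmetricDirections (ha : a ∈ positiveDirections Ω u)
    (hz : z ∈ symmetricDirections u) (s : ℝ) : a + s • z ∉ symmetricDirections u := by
  intro hb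
  have haZ := notMem_symmetricDirections hΩ hne ha
  have ha0 := ha.1
  have hz0 : z ≠ 0 := by
    rintro rfl
    rw [smul_zero, add_zero] at hb
    exact haZ hb
  have hb0 : a + s • z ≠ 0 := by
    intro h
    refine haZ ?_
    rw [eq_neg_of_add_eq_zero_left h, ← neg_smul]
    exact smul_mem_symmetricDirections hz _
  obtain ⟨b, hbdef⟩ : ∃ b, b = a + s • z := ⟨_, rfl⟩
  have hcomp := hypRefl_comp_three a z s ha0 hz0 hb0
  rw [← hbdef] at hb hb0 hcomp
  have hhalf : ∀ x ∈ Ω, 0 < inner ℝ x a → 0 < inner ℝ x (hypRefl b (hypRefl z a)) := by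
    intro x hx hxa
    rw [← inner_hypRefl_left, ← inner_hypRefl_left]
    set y := hypRefl z (hypRefl b x) with hy
    have hyΩ : hypRefl a y ∈ Ω := hΩ x _ (by simp [hy]) hx
    have e1 : u y = u x := by rw [hy, hz, hb]
    have e2 : u (hypRefl a y) = u (hypRefl a x) := by rw [hy, hcomp, hb, hz]
    have h1 := ha.2 x hx hxa
    by_contra hcon
    rcases (not_lt.1 hcon).eq_or_lt with h | h
    · rw [hypRefl_eq_self h] at e2
      linarith
    · have h2 := ha.2 _ hyΩ (by rw [inner_hypRefl]; linarith)
      rw [hypRefl_hypRefl] at h2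
      linarith
  have hfix : hypRefl b (hypRefl z a) = a := by
    by_contra hcon
    obtain ⟨d, hd⟩ : ∃ d, d = a - hypRefl b (hypRefl z a) := ⟨_, rfl⟩
    have hd0 : d ≠ 0 := by
      rw [hd]
      exact sub_ne_zero.2 (Ne.symm hcon)
    obtain ⟨c, hc, hcd⟩ := exists_pos_smul_mem hΩ hne hd0
    have hnorm : ‖hypRefl b (hypRefl z a)‖ = ‖a‖ := by simp
    have i1 : ‖d‖ ^ 2 = 2 * inner ℝ d a := by
      rw [hd, norm_sub_sq_real, inner_sub_left, real_inner_self_eq_norm_sq, hnorm,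
        real_inner_comm a]
      ring
    have i2 : inner ℝ d (hypRefl b (hypRefl z a)) = - inner ℝ d a := by
      rw [hd, inner_sub_left, inner_sub_left, real_inner_self_eq_norm_sq,
        real_inner_self_eq_norm_sq, hnorm, real_inner_comm a]
      ring
    have hdpos : 0 < ‖d‖ ^ 2 := by have := norm_pos_iff.2 hd0; positivity
    have h3 := hhalf _ hcd (by
      rw [real_inner_smul_left]
      exact mul_pos hc (by linarith))
    rw [real_inner_smul_left, i2] at h3
    have := pos_of_mul_pos_right h3 hc.le
    linarith
  have heq : hypRefl z a = hypRefl b a := by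
    rw [← hypRefl_hypRefl b (hypRefl z a), hfix]
  rw [hypRefl_apply, hypRefl_apply, sub_right_inj] at heq
  have hzn : ‖z‖ ^ 2 ≠ 0 := pow_ne_zero _ (norm_ne_zero_iff.2 hz0)
  have hbn : ‖b‖ ^ 2 ≠ 0 := pow_ne_zero _ (norm_ne_zero_iff.2 hb0)
  rcases eq_or_ne (inner ℝ a b) 0 with h | h
  · have haz : inner ℝ a z = 0 := by
      rw [h, mul_zero, zero_div, zero_smul, smul_eq_zero, or_iff_left hz0, div_eq_zero_iff,
        or_iff_left hzn] at heq
      linarith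
    rw [hbdef, inner_add_right, real_inner_smul_right, haz, mul_zero, add_zero,
      inner_self_eq_zero] at h
    exact ha0 h
  · set α := 2 * inner ℝ a z / ‖z‖ ^ 2
    set β := 2 * inner ℝ a b / ‖b‖ ^ 2 with hβ
    have hβ0 : β ≠ 0 := div_ne_zero (mul_ne_zero two_ne_zero h) hbn
    refine haZ ?_
    have : a = (β⁻¹ * α - s) • z := by
      rw [sub_smul, mul_smul, heq, smul_smul, inv_mul_cancel₀ hβ0, one_smul, hbdef,
        add_sub_cancel_right]
    rw [this]
    exact smul_mem_symmetricDirections hz _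

omit hΩ hne in
/-- A path leaving the positive directions passes through a symmetric direction. -/
theorem exists_mem_symmetricDirections_of_path (hopen : IsOpen (positiveDirections Ω u))
    (hcl : closure (positiveDirections Ω u) ⊆ positiveDirections Ω u ∪ symmetricDirections u)
    (ha : a ∈ positiveDirections Ω u) (hw : w ∉ positiveDirections Ω u) :
    ∃ t : ℝ, 0 < t ∧ t ≤ 1 ∧ (1 - t) • a + t • w ∈ symmetricDirections u := by
  by_contra hcon
  push Not at hcon
  have hpre : IsPreconnected ((fun t : ℝ => (1 - t) • a + t • w) '' Icc 0 1) := by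
    refine isPreconnected_Icc.image _ (Continuous.continuousOn ?_)
    fun_prop
  have hsub := hpre.subset_of_closure_inter_subset hopen
    ⟨a, ⟨0, ⟨le_rfl, zero_le_one⟩, by simp⟩, ha⟩ ?_
  · exact hw (hsub ⟨1, ⟨zero_le_one, le_rfl⟩, by simp⟩)
  rintro _ ⟨hc, t, ⟨ht0, ht1⟩, rfl⟩
  rcases ht0.eq_or_lt with rfl | ht0
  · simpa using ha
  · exact (hcl hc).resolve_right (hcon t ht0 ht1)

variable (hopen : IsOpen (positiveDirections Ω u))
  (hcl : closure (positiveDirections Ω u) ⊆ positiveDirections Ω u ∪ symmetricDirections u)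
include hopen hcl

theorem add_smul_mem_positiveDirections (ha : a ∈ positiveDirections Ω u)
    (hz : z ∈ symmetricDirections u) (s : ℝ) : a + s • z ∈ positiveDirections Ω u := by
  by_contra hcon
  obtain ⟨t, -, -, ht⟩ := exists_mem_symmetricDirections_of_path hopen hcl ha hcon
  refine add_smul_notMem_symmetricDirections hΩ hne ha hz (t * s) ?_
  convert ht using 1
  module

/-- If a proper convex combination of a positive direction `a` and `w` is a symmetric direction,
then `-w` is a positive direction. -/
theorem neg_mem_positiveDirections (ha : a ∈ positiveDirections Ω u) {t : ℝ} (h0 : 0 < t)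
    (h1 : t < 1) (h : (1 - t) • a + t • w ∈ symmetricDirections u) :
    -w ∈ positiveDirections Ω u := by
  have h2 := add_smul_mem_positiveDirections hΩ hne hopen hcl
    (smul_mem_positiveDirections ha (sub_pos.2 h1)) h (-1)
  have h3 := smul_mem_positiveDirections h2 (inv_pos.2 h0)
  convert h3 using 1
  match_scalars <;> field_simp
  ring

theorem convex_positiveDirections : Convex ℝ (positiveDirections Ω u) := by
  rw [convex_iff_forall_pos]
  intro a ha b hb α β hα hβ hαβ
  by_contra hcon
  obtain ⟨t, h0, h1, ht⟩ := exists_mem_symmetricDirections_of_path hopen hcl ha hcon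
  have hβ1 : t * β < 1 := by nlinarith
  refine neg_notMem_positiveDirections hΩ hne hb
    (neg_mem_positiveDirections hΩ hne hopen hcl ha (mul_pos h0 hβ) hβ1 ?_)
  convert ht using 1
  obtain rfl : α = 1 - β := by linarith
  module

theorem mem_or_neg_mem_or_mem_symmetricDirections (ha : a ∈ positiveDirections Ω u) (w : E) :
    w ∈ positiveDirections Ω u ∨ -w ∈ positiveDirections Ω u ∨ w ∈ symmetricDirections u := by
  by_contra! hcon
  obtain ⟨h1, h2, h3⟩ := hcon
  obtain ⟨t, ht0, ht1, ht⟩ := exists_mem_symmetricDirections_of_path hopen hcl ha h1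
  rcases ht1.eq_or_lt with rfl | ht1
  · exact h3 (by simpa using ht)
  · exact h2 (neg_mem_positiveDirections hΩ hne hopen hcl ha ht0 ht1 ht)

/-- The positive directions form an open convex cone which, together with its opposite and the
symmetric directions, exhausts the space. Separating it from the origin yields the axis `p`: on
each sphere in `Ω`, the function `u` is nondecreasing in `⟪x, p⟫`. -/
theorem exists_axis [FiniteDimensional ℝ E] (hpos : (positiveDirections Ω u).Nonempty) :
    ∃ p : E, ‖p‖ = 1 ∧ ∀ x y, x ∈ Ω → ‖x‖ = ‖y‖ → inner ℝ y p ≤ inner ℝ x p → u y ≤ u x := by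
  obtain ⟨a, ha⟩ := hpos
  obtain ⟨f, hf⟩ := geometric_hahn_banach_open_point
    (convex_positiveDirections hΩ hne hopen hcl) hopen (x := (0 : E)) fun h => h.1 rfl
  rw [map_zero] at hf
  set q := -(InnerProductSpace.toDual ℝ E).symm f with hq
  have hqC : ∀ w ∈ positiveDirections Ω u, 0 < inner ℝ w q := by
    intro w hw
    rw [hq, inner_neg_right, real_inner_comm, InnerProductSpace.toDual_symm_apply]
    linarith [hf w hw]
  have hq0 : q ≠ 0 := by
    intro h
    have := hqC a ha
    rw [h, inner_zero_right] at this
    exact this.false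
  have hqn : 0 < ‖q‖ := norm_pos_iff.2 hq0
  refine ⟨‖q‖⁻¹ • q, by rw [norm_smul, norm_inv, norm_norm, inv_mul_cancel₀ hqn.ne'], ?_⟩
  intro x y hx hxy hle
  rw [real_inner_smul_right, real_inner_smul_right,
    mul_le_mul_iff_right₀ (inv_pos.2 hqn)] at hle
  rcases eq_or_ne x y with rfl | hne'
  · exact le_rfl
  have hrefl : hypRefl (x - y) x = y := Submodule.reflection_sub hxy
  have hxw : 0 < inner ℝ x (x - y) := by
    have h1 : 0 < ‖x - y‖ ^ 2 := by
      have := norm_pos_iff.2 (sub_ne_zero.2 hne')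
      positivity
    rw [norm_sub_sq_real, ← hxy] at h1
    rw [inner_sub_right, real_inner_self_eq_norm_sq]
    linarith
  rcases mem_or_neg_mem_or_mem_symmetricDirections hΩ hne hopen hcl ha (x - y) with h | h | h
  · have := h.2 x hx hxw
    rw [hrefl] at this
    exact this.le
  · have := hqC _ h
    rw [inner_neg_left, inner_sub_left] at this
    linarith
  · have := h x
    rw [hrefl] at this
    exact this.le

end Directions

section DirectionsTopology

variable {E : Type*} [NormedAddCommGroup E] [InnerProductSpace ℝ E] {Ω : Set E} {u : E → ℝ} {w : E}

theorem continuousAt_sub_hypRefl (hΩ : IsOpen Ω) (hΩr : ∀ x y : E, ‖x‖ = ‖y‖ → x ∈ Ω → y ∈ Ω)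
    (hu : ContinuousOn u Ω) (hw : w ≠ 0) {x : E} (hx : x ∈ Ω) :
    ContinuousAt (fun p : E × E => u p.2 - u (hypRefl p.1 p.2)) (w, x) := by
  have h1 : ContinuousAt u x := hu.continuousAt (hΩ.mem_nhds hx)
  have h2 : ContinuousAt u (hypRefl w x) := hu.continuousAt
    (hΩ.mem_nhds (hΩr x _ (LinearIsometryEquiv.norm_map _ _).symm hx))
  refine ContinuousAt.sub ?_ ?_
  · exact ContinuousAt.comp (f := Prod.snd) (x := (w, x)) h1 continuousAt_snd
  · exact ContinuousAt.comp (f := fun p : E × E => hypRefl p.1 p.2) (x := (w, x)) h2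
      (continuousAt_hypRefl hw x)

/-- A limit of positive directions is positive, by the strong maximum principle, unless it is a
direction of symmetry. -/
theorem closure_positiveDirections_subset (hΩ : IsOpen Ω)
    (hΩr : ∀ x y : E, ‖x‖ = ‖y‖ → x ∈ Ω → y ∈ Ω) (hu : ContinuousOn u Ω)
    (hu0 : ∀ x, x ∉ Ω → u x = 0)
    (hstrong : ∀ w, (∀ x, 0 < inner ℝ x w → u (hypRefl w x) ≤ u x) →
      ∀ x₁ ∈ Ω, 0 < inner ℝ x₁ w → u (hypRefl w x₁) < u x₁ →
      ∀ x ∈ Ω, 0 < inner ℝ x w → u (hypRefl w x) < u x) :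
    closure (positiveDirections Ω u) ⊆ positiveDirections Ω u ∪ symmetricDirections u := by
  intro w hw
  rcases eq_or_ne w 0 with rfl | hw0
  · exact Or.inr fun x => by simp
  have hout : ∀ x, x ∉ Ω → u (hypRefl w x) = u x := fun x hx => by
    rw [hu0 x hx, hu0 _ fun h => hx (hΩr _ _ (LinearIsometryEquiv.norm_map _ _) h)]
  have hle : ∀ x, 0 < inner ℝ x w → u (hypRefl w x) ≤ u x := by
    intro x hxw
    by_cases hx : x ∈ Ω
    · by_contra hcon
      have h1 : ∀ᶠ w' in nhds w, u x - u (hypRefl w' x) < 0 :=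
        ((continuousAt_sub_hypRefl hΩ hΩr hu hw0 hx).comp
          (f := fun w' : E => (w', x)) (by fun_prop)).eventually_lt_const
            (by simpa using hcon)
      have h2 : ∀ᶠ w' in nhds w, 0 < inner ℝ x w' :=
        (show ContinuousAt (fun w' : E => inner ℝ x w') w by fun_prop).eventually_const_lt hxw
      obtain ⟨w', hw', h1', h2'⟩ :=
        ((mem_closure_iff_frequently.1 hw).and_eventually (h1.and h2)).exists
      have := hw'.2 x hx h2'
      linarith
    · exact (hout x hx).le
  by_cases hex : ∃ x₁ ∈ Ω, 0 < inner ℝ x₁ w ∧ u (hypRefl w x₁) < u x₁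
  · obtain ⟨x₁, h1, h2, h3⟩ := hex
    exact Or.inl ⟨hw0, hstrong w hle x₁ h1 h2 h3⟩
  · push Not at hex
    have heq : ∀ x ∈ Ω, 0 < inner ℝ x w → u (hypRefl w x) = u x := fun x hx hxw =>
      le_antisymm (hle x hxw) (hex x hx hxw)
    refine Or.inr fun x => ?_
    by_cases hx : x ∈ Ω
    · rcases lt_trichotomy (inner ℝ x w) 0 with h | h | h
      · have := heq (hypRefl w x) (hΩr x _ (LinearIsometryEquiv.norm_map _ _).symm hx) (by
          rw [inner_hypRefl]
          linarith)
        rw [hypRefl_hypRefl] at this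
        exact this.symm
      · rw [hypRefl_eq_self h]
      · exact heq x hx h
    · exact hout x hx

variable [FiniteDimensional ℝ E] [MeasurableSpace E] [BorelSpace E]

theorem volume_inner_eq_zero (hw : w ≠ 0) : volume {x : E | inner ℝ x w = 0} = 0 := by
  have : {x : E | inner ℝ x w = 0} = ((innerSL ℝ w).toLinearMap.ker : Set E) := by
    ext x
    simp [real_inner_comm]
  rw [this]
  refine Measure.addHaar_submodule _ _ fun h => hw ?_
  have hmem : w ∈ (innerSL ℝ w).toLinearMap.ker := h ▸ Submodule.mem_top
  simpa using hmem

/-- Strict positivity persists on a compact part of `Ω` when the direction is perturbed. The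
maximum principle for small measure extends it to a weak inequality on the half-space, and the
strong maximum principle makes the inequality strict. -/
theorem isOpen_positiveDirections (hΩ : IsOpen Ω) (hΩb : Bornology.IsBounded Ω)
    (hΩr : ∀ x y : E, ‖x‖ = ‖y‖ → x ∈ Ω → y ∈ Ω) (hne : ∃ x ∈ Ω, x ≠ 0)
    (hu : ContinuousOn u Ω)
    (hstrong : ∀ w, (∀ x, 0 < inner ℝ x w → u (hypRefl w x) ≤ u x) →
      ∀ x₁ ∈ Ω, 0 < inner ℝ x₁ w → u (hypRefl w x₁) < u x₁ →
      ∀ x ∈ Ω, 0 < inner ℝ x w → u (hypRefl w x) < u x)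
    (hsmall : ∃ δ : ℝ, 0 < δ ∧ ∀ (w : E) (K : Set E), MeasurableSet K →
      volume (Ω \ K) ≤ ENNReal.ofReal δ →
      (∀ x ∈ K, 0 < inner ℝ x w → u (hypRefl w x) ≤ u x) →
      ∀ x, 0 < inner ℝ x w → u (hypRefl w x) ≤ u x) :
    IsOpen (positiveDirections Ω u) := by
  rw [isOpen_iff_mem_nhds]
  intro w hw
  obtain ⟨δ, hδ, hsmall⟩ := hsmall
  have hw0 := hw.1
  have hev : ∀ x ∈ Ω, 0 < inner ℝ x w →
      ∀ᶠ p : E × E in nhds (w, x), 0 < inner ℝ p.2 p.1 ∧ u (hypRefl p.1 p.2) < u p.2 := by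
    intro x hx hxw
    have h1 : ∀ᶠ p : E × E in nhds (w, x), 0 < u p.2 - u (hypRefl p.1 p.2) :=
      (continuousAt_sub_hypRefl hΩ hΩr hu hw0 hx).eventually_const_lt
        (sub_pos.2 (hw.2 x hx hxw))
    have h2 : ∀ᶠ p : E × E in nhds (w, x), 0 < inner ℝ p.2 p.1 :=
      (show ContinuousAt (fun p : E × E => inner ℝ p.2 p.1) (w, x) by
        fun_prop).eventually_const_lt hxw
    filter_upwards [h1, h2] with p hp1 hp2
    exact ⟨hp2, sub_pos.1 hp1⟩
  have hΩ' : IsOpen (Ω ∩ {x | inner ℝ x w ≠ 0}) :=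
    hΩ.inter (isOpen_ne_fun (by fun_prop) continuous_const)
  obtain ⟨K, hKΩ, hKc, hKvol⟩ := hΩ'.measurableSet.exists_isCompact_sdiff_lt (μ := volume)
    ((measure_mono inter_subset_left).trans_lt hΩb.measure_lt_top).ne
    (ε := ENNReal.ofReal δ) (by simpa using hδ)
  have hvol : volume (Ω \ K) ≤ ENNReal.ofReal δ := by
    have hsub : Ω \ K ⊆ (Ω ∩ {x | inner ℝ x w ≠ 0}) \ K ∪ {x | inner ℝ x w = 0} := by
      rintro x ⟨hx, hxK⟩
      by_cases h : inner ℝ x w = 0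
      · exact Or.inr h
      · exact Or.inl ⟨⟨hx, h⟩, hxK⟩
    refine (measure_mono hsub).trans ((measure_union_le _ _).trans ?_)
    rw [volume_inner_eq_zero hw0, add_zero]
    exact hKvol.le
  -- the two halves of the compact set are compact, as it avoids the hyperplane
  have hK1 : IsCompact (K ∩ {x | 0 ≤ inner ℝ x w}) :=
    hKc.inter_right (isClosed_le continuous_const (by fun_prop))
  have hK2 : IsCompact (K ∩ {x | inner ℝ x w ≤ 0}) :=
    hKc.inter_right (isClosed_le (by fun_prop) continuous_const)
  have hev1 : ∀ᶠ w' in nhds w, ∀ x ∈ K ∩ {x | 0 ≤ inner ℝ x w},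
      0 < inner ℝ x w' ∧ u (hypRefl w' x) < u x := by
    refine hK1.eventually_forall_of_forall_eventually
      (P := fun w' x => 0 < inner ℝ x w' ∧ u (hypRefl w' x) < u x) ?_
    rintro x ⟨hxK, hx⟩
    exact hev x (hKΩ hxK).1 (lt_of_le_of_ne hx (hKΩ hxK).2.symm)
  have hev2 : ∀ᶠ w' in nhds w, ∀ x ∈ K ∩ {x | inner ℝ x w ≤ 0}, inner ℝ x w' < 0 := by
    refine hK2.eventually_forall_of_forall_eventually (P := fun w' x => inner ℝ x w' < 0) ?_
    rintro x ⟨hxK, hx⟩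
    exact (show ContinuousAt (fun p : E × E => inner ℝ p.2 p.1) (w, x) by
      fun_prop).eventually_lt_const (lt_of_le_of_ne hx (hKΩ hxK).2)
  obtain ⟨c, hc, hcΩ⟩ := exists_pos_smul_mem hΩr hne hw0
  have hev3 : ∀ᶠ w' in nhds w, 0 < inner ℝ (c • w) w' ∧ u (hypRefl w' (c • w)) < u (c • w) := by
    have hpos : 0 < inner ℝ (c • w) w := by
      rw [real_inner_smul_left]
      exact mul_pos hc (real_inner_self_pos.2 hw0)
    have ht : Filter.Tendsto (fun w' : E => (w', c • w)) (nhds w) (nhds (w, c • w)) :=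
      Continuous.tendsto (by fun_prop) w
    exact ht.eventually (hev _ hcΩ hpos)
  filter_upwards [hev1, hev2, hev3, eventually_ne_nhds hw0] with w' h1 h2 h3 h4
  have hle := hsmall w' K hKc.measurableSet hvol fun x hxK hxw' => by
    rcases le_total 0 (inner ℝ x w) with h | h
    · exact (h1 x ⟨hxK, h⟩).2.le
    · exact absurd (h2 x ⟨hxK, h⟩) hxw'.not_gt
  exact ⟨h4, hstrong w' hle _ hcΩ h3.1 h3.2⟩

end DirectionsTopology

/-! ### Foliated Schwarz symmetry -/

section Foliated

variable {N : ℕ} {Ω : Set (EuclideanSpace ℝ (Fin N))} {u : EuclideanSpace ℝ (Fin N) → ℝ}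

theorem angle_le_angle_iff_inner_le {E : Type*} [NormedAddCommGroup E] [InnerProductSpace ℝ E]
    {x y p : E} (hxy : ‖x‖ = ‖y‖) (hx : x ≠ 0) (hp : p ≠ 0) :
    InnerProductGeometry.angle x p ≤ InnerProductGeometry.angle y p ↔
      inner ℝ y p ≤ inner ℝ x p := by
  have hy : y ≠ 0 := by rwa [← norm_ne_zero_iff, ← hxy, norm_ne_zero_iff]
  have h : 0 < ‖y‖ * ‖p‖ := mul_pos (norm_pos_iff.2 hy) (norm_pos_iff.2 hp)
  rw [← Real.strictAntiOn_cos.le_iff_ge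
    ⟨InnerProductGeometry.angle_nonneg _ _, InnerProductGeometry.angle_le_pi _ _⟩
    ⟨InnerProductGeometry.angle_nonneg _ _, InnerProductGeometry.angle_le_pi _ _⟩,
    InnerProductGeometry.cos_angle, InnerProductGeometry.cos_angle, hxy,
    div_le_div_iff_of_pos_right h]

/-- A continuous function which on spheres is a nondecreasing function of `⟪x, p⟫` has geodesic
balls as superlevel sets: the radius is the largest angle attained in the superlevel set. -/
theorem isFoliatedSchwarzSymmetric_of_monotone (hu : ContinuousOn u Ω)
    {p : EuclideanSpace ℝ (Fin N)} (hp : ‖p‖ = 1)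
    (h : ∀ x y, x ∈ Ω → ‖x‖ = ‖y‖ → inner ℝ y p ≤ inner ℝ x p → u y ≤ u x) :
    IsFoliatedSchwarzSymmetric Ω u := by
  refine ⟨p, hp, fun r hr hrΩ c => ?_⟩
  by_cases hS : {x | ‖x‖ = r ∧ c ≤ u x} = ∅
  · exact Or.inl hS
  refine Or.inr (Or.inr ?_)
  have hset : {x | ‖x‖ = r ∧ c ≤ u x} =
      Metric.sphere (0 : EuclideanSpace ℝ (Fin N)) r ∩ u ⁻¹' Ici c := by
    ext x
    simp
  have hcomp : IsCompact {x | ‖x‖ = r ∧ c ≤ u x} := by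
    rw [hset]
    refine (isCompact_sphere _ _).of_isClosed_subset ?_ inter_subset_left
    exact (hu.mono hrΩ).preimage_isClosed_of_isClosed Metric.isClosed_sphere isClosed_Ici
  obtain ⟨y, ⟨hyr, hyc⟩, hmin⟩ := hcomp.exists_isMinOn (nonempty_iff_ne_empty.2 hS)
    (f := fun x => inner ℝ x p) (by fun_prop)
  have hp0 : r • p ≠ 0 := smul_ne_zero hr.ne' (norm_ne_zero_iff.1 (by rw [hp]; norm_num))
  refine ⟨r * InnerProductGeometry.angle y (r • p),
    mul_nonneg hr.le (InnerProductGeometry.angle_nonneg _ _), ?_⟩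
  ext x
  simp only [geodesicBall, mem_ofPred_eq]
  refine and_congr_right fun hxr => ?_
  have hx0 : x ≠ 0 := norm_ne_zero_iff.1 (by rw [hxr]; exact hr.ne')
  have hxΩ : x ∈ Ω := hrΩ (by simpa using hxr)
  rw [mul_le_mul_iff_right₀ hr, angle_le_angle_iff_inner_le (hxr.trans hyr.symm) hx0 hp0,
    real_inner_smul_right, real_inner_smul_right, mul_le_mul_iff_right₀ hr]
  constructor
  · intro hx
    exact hmin ⟨hxr, hx⟩
  · intro hx
    exact hyc.trans (h x y hxΩ (hxr.trans hyr.symm) hx)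

end Foliated

theorem mainTheorem1 (N : ℕ) (hN : 2 ≤ N)
    (Ω : Set (EuclideanSpace ℝ (Fin N)))
    (hΩ_open : IsOpen Ω) (hΩ_bdd : Bornology.IsBounded Ω) (hΩ_radial : IsRadialSet Ω)
    (k : ℝ → ℝ) (hk : KernelCondition N k)
    (hk_strict : ¬ IsConnected Ω → StrictAntiOn k (Ioi 0))
    (f : ℝ → ℝ → ℝ) (hf : UniformlyLocallyLipschitz f)
    (u : EuclideanSpace ℝ (Fin N) → ℝ)
    (hu_sol : IsWeakSolution k f Ω u)
    (hu_bdd : ∃ C : ℝ, ∀ x, |u x| ≤ C)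
    (hu_cont : ContinuousOn u Ω)
    (hu_refl : ReflectionInequality u) :
    IsFoliatedSchwarzSymmetric Ω u := by
  obtain ⟨L, hL, hv⟩ := hu_sol.isAntisymmetricSupersolution hN hΩ_open hΩ_bdd hΩ_radial hk hf
    hu_bdd hu_cont
  have hk' := hk.isLevyKernel hN
  have hcongr : ∀ s ⊆ Ioi (0 : ℝ), StrictAntiOn k s → StrictAntiOn ((Ioi 0).indicator k) s :=
    fun s hs h => h.congr fun r hr => (indicator_of_mem (hs hr) k).symm
  have hnear : ∃ R : ℝ, 0 < R ∧ StrictAntiOn ((Ioi 0).indicator k) (Ioo 0 R) := by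
    obtain ⟨R, hR, hs⟩ := hk.strict_near_zero
    exact ⟨R, hR, hcongr _ (fun r hr => hr.1) hs⟩
  have hstrong : ∀ w, (∀ x, 0 < inner ℝ x w → u (hypRefl w x) ≤ u x) →
      ∀ x₁ ∈ Ω, 0 < inner ℝ x₁ w → u (hypRefl w x₁) < u x₁ →
      ∀ x ∈ Ω, 0 < inner ℝ x w → u (hypRefl w x) < u x := by
    intro w h x₁ h₁ h₁w h₁u x hx hxw
    exact sub_pos.1 ((hv w).pos hk' hΩ_open hΩ_bdd hΩ_radial hL hnear
      (fun hc => hcongr _ Subset.rfl (hk_strict hc)) (fun y hy => sub_nonneg.2 (h y hy)) h₁ h₁w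
      (sub_pos.2 h₁u) hx hxw)
  have hsmall : ∃ δ : ℝ, 0 < δ ∧ ∀ (w : EuclideanSpace ℝ (Fin N))
      (K : Set (EuclideanSpace ℝ (Fin N))), MeasurableSet K →
      volume (Ω \ K) ≤ ENNReal.ofReal δ →
      (∀ x ∈ K, 0 < inner ℝ x w → u (hypRefl w x) ≤ u x) →
      ∀ x, 0 < inner ℝ x w → u (hypRefl w x) ≤ u x := by
    obtain ⟨δ, hδ, h⟩ := exists_small_volume_maximum_principle hk' hΩ_open hΩ_bdd L
    exact ⟨δ, hδ, fun w K hK hvol hKu x hx => sub_nonneg.1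
      (h w _ (hv w) K hK hvol (fun y hy hyw => sub_nonneg.2 (hKu y hy hyw)) x hx)⟩
  obtain ⟨e, he, hle, x₁, hx₁, hne⟩ := hu_refl
  have hx₁u : u (hypRefl e x₁) < u x₁ := lt_of_le_of_ne (hle x₁ hx₁) (Ne.symm hne)
  have hx₁Ω : x₁ ∈ Ω := by
    by_contra h
    rw [hu_sol.mem.eq_zero _ h, hu_sol.mem.eq_zero _ (hΩ_radial.hypRefl_notMem e h)] at hx₁u
    exact hx₁u.false
  have he0 : e ≠ 0 := norm_ne_zero_iff.1 (by rw [he]; exact one_ne_zero)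
  have hx₁0 : x₁ ≠ 0 := by
    rintro rfl
    simp at hx₁
  have hpos : (positiveDirections Ω u).Nonempty :=
    ⟨e, he0, hstrong e hle x₁ hx₁Ω hx₁ hx₁u⟩
  obtain ⟨p, hp, hmono⟩ := exists_axis hΩ_radial ⟨x₁, hx₁Ω, hx₁0⟩
    (isOpen_positiveDirections hΩ_open hΩ_bdd hΩ_radial ⟨x₁, hx₁Ω, hx₁0⟩ hu_cont hstrong hsmall)
    (closure_positiveDirections_subset hΩ_open hΩ_radial hu_cont hu_sol.mem.eq_zero hstrong) hpos
  exact isFoliatedSchwarzSymmetric_of_monotone hu_cont hp hmono
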